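/- Let $k$ be a field and let $\Pi A_2$ be the preprojective algebra of the $A_2$ quiver: it has the $k$-basis $(1),(2),(12),(21)$, where $(1),(2)$ are orthogonal idempotents with sum $1$, $(12)$ and $(21)$ are arrows $1\to2$ and $2\to1$, and all products of two arrows vanish. Let $S_1,S_2$ be its simple modules and $P_1,P_2$ their projective covers, and let $Q_i=[\cdots\to P_i\to P_{i+1}\to P_i]$ (indices mod $2$, degrees $\le 0$, differentials given by the arrows) be the periodic projective resolution of $S_i$. Let $\mathcal E$ be the dg category with the four objects $S_1,S_2,P_1,P_2$ and the morphism complexes $\mathrm{Hom}^*$ between the complexes $Q_1,Q_2,P_1,P_2$. Its cohomology is $\mathrm{Ext}^*$ of the four modules. A contraction of $\mathcal E$ onto its cohomology consists of maps $i$ (a choice of cocycle representatives) and $p$ of degree $0$ and a map $H$ of degree $-1$, for each pair of objects, with $pd=0$, $pi=1$, $1-ip=dH+Hd$, $H^2=0$ and $Hi=0$. It defines $A_\infty$-operations $m_d=\sum_T m_d^T$ on $\mathrm{Ext}^*$ (with $m_1=0$), where $T$ runs over the planar rooted binary trees with $d$ leaves and $m_d^T$ is obtained by labelling leaves by $i$,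 branch points by $(g,f)\mapsto(-1)^{|f|}g\circ f$, internal edges by $f\mapsto(-1)^{|f|}H(f)$ and the root by $p$. Let $\Pi$ be the resulting category with objects $S_1,S_2,P_1,P_2$, and let $\alpha\in\mathrm{Ext}^1(S_2,S_1)$, $\beta\in\mathrm{Ext}^1(S_1,S_2)$ be the classes of the chain maps $Q_2\to Q_1[1]$ and $Q_1\to Q_2[1]$ that are $(-1)^m$ times the identity into each degree $m\le0$. Contractions exist, and for every contraction the following hold. 1. $\Pi$ and its full subcategory $\pi$ on the objects $S_1,S_2$ are strictly unital $A_\infty$-categories, and $\pi$ is generated by $\alpha$ and $\beta$ (under $m_2$, linear combinations, and starting from the identities). 2. $\pi$ is formal: $m_1^\pi=0$ and $m_d^\pi=0$ for all $d>2$. 3. The inclusion $\iota:\pi\hookrightarrow\Pi$, with $\iota(S_i)=S_i$, $\iota^1(f)=f$ for all morphisms $f$, and $\iota^d=0$ for $d\ge2$, is a (strict) $A_\infty$-functor. It is the only $A_\infty$-functor that is $S_i\mapsto S_i$ on objects with $\iota^1(\alpha)=\alpha$, $\iota^1(\beta)=\beta$ and $\iota^d=0$ for $d\ge2$. -/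

import Mathlib

open CategoryTheory DirectSum

universe u v w w'

noncomputable section

/-! ### Composable sequences and planar binary trees -/

/-- Composable sequences `(f_d, …, f_1)` of elements of a family `T X Y`. In `cons f p` the
element `f` is `f_1`, the one that is applied first, and `p` is `(f_d, …, f_2)`. -/
inductive CSeq {Obj : Type v} (T : Obj → Obj → Type w) : Obj → Obj → Type (max v w)
  | nil (X : Obj) : CSeq T X X
  | cons {X Y Z : Obj} (f : T X Y) (p : CSeq T Y Z) : CSeq T X Z

namespace CSeq

variable {Obj : Type v} {T : Obj → Obj → Type w}

/-- The sequence with the single entry `f`. -/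
def single {X Y : Obj} (f : T X Y) : CSeq T X Y := cons f (nil Y)

/-- The sequence `(g, f)` with two entries; `f` is applied first. -/
def pair {X Y Z : Obj} (g : T Y Z) (f : T X Y) : CSeq T X Z := cons f (single g)

/-- The number of entries. -/
def length {X Y : Obj} : CSeq T X Y → ℕ
  | nil _ => 0
  | cons _ p => p.length + 1

/-- Concatenation; the entries of the first argument are applied first. -/
def append {X Y Z : Obj} : CSeq T X Y → CSeq T Y Z → CSeq T X Z
  | nil _, q => q
  | cons f p, q => cons f (p.append q)

/-- Apply a map on objects and a map on entries to a sequence. -/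
def map {Obj' : Type w'} {T' : Obj' → Obj' → Type w} (F : Obj → Obj')
    (φ : ∀ {X Y : Obj}, T X Y → T' (F X) (F Y)) {X Y : Obj} : CSeq T X Y → CSeq T' (F X) (F Y)
  | nil X => nil (F X)
  | cons f p => cons (φ f) (p.map F φ)

/-- All ways of cutting a sequence into two consecutive, possibly empty, pieces; the first piece
is the one that is applied first. -/
def cuts {X Z : Obj} : CSeq T X Z → List (Σ Y : Obj, CSeq T X Y × CSeq T Y Z)
  | nil X => [⟨X, nil X, nil X⟩]
  | cons (X := X) f p =>
      ⟨X, nil X, cons f p⟩ :: p.cuts.map (fun c => ⟨c.1, cons f c.2.1, c.2.2⟩)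

/-- All ways of cutting a sequence into two consecutive pieces, the first one not empty. -/
def properCuts {X Z : Obj} : CSeq T X Z → List (Σ Y : Obj, CSeq T X Y × CSeq T Y Z)
  | nil _ => []
  | cons f p => p.cuts.map (fun c => ⟨c.1, cons f c.2.1, c.2.2⟩)

end CSeq

/-- Planar rooted binary trees whose leaves are labelled by composable elements. In `node l r` the
labels of `l` are applied before those of `r`. -/
inductive BTree {Obj : Type v} (T : Obj → Obj → Type w) : Obj → Obj → Type (max v w)
  | leaf {X Y : Obj} (f : T X Y) : BTree T X Y
  | node {X Y Z : Obj} (l : BTree T X Y) (r : BTree T Y Z) : BTree T X Z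

namespace CSeq

variable {Obj : Type v} {T : Obj → Obj → Type w}

/-- The one-leaf tree on a sequence with exactly one entry. -/
def leafTree {X Y : Obj} : CSeq T X Y → List (BTree T X Y)
  | nil _ => []
  | cons f (nil _) => [BTree.leaf f]
  | cons _ (cons _ _) => []

/-- The planar binary trees of height less than `n` whose leaves spell a given sequence. -/
def treesAux : ℕ → ∀ {X Y : Obj}, CSeq T X Y → List (BTree T X Y)
  | 0, _, _, _ => []
  | n + 1, _, _, p => p.leafTree ++ p.cuts.flatMap (fun c =>
      (treesAux n c.2.1).flatMap (fun l => (treesAux n c.2.2).map (fun r => BTree.node l r)))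

/-- All planar binary trees whose leaves spell the sequence `p`, each listed once. (A tree with `d`
leaves has height less than `d`.) -/
def trees {X Y : Obj} (p : CSeq T X Y) : List (BTree T X Y) := treesAux p.length p

end CSeq

/-! ### `A_∞`-categories and `A_∞`-functors -/

/-- The data of a (unital) `A_∞`-category: objects, `ℤ`-graded morphism modules, the operations
`m_d` (evaluated on composable sequences of `d` not necessarily homogeneous morphisms), and a
degree zero endomorphism of each object. The axioms are in `AInfData.IsAInfCategory`. -/
structure AInfData (k : Type u) [CommRing k] where
  Obj : Type v
  Hom : Obj → Obj → ℤ → Type w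
  [addCommGroup : ∀ X Y n, AddCommGroup (Hom X Y n)]
  [module : ∀ X Y n, Module k (Hom X Y n)]
  m : ∀ {X Y : Obj}, CSeq (fun X Y => ⨁ n, Hom X Y n) X Y → ⨁ n, Hom X Y n
  one : ∀ X : Obj, Hom X X 0

attribute [instance] AInfData.addCommGroup AInfData.module

/-- The degree `n` elements of a graded module. -/
def homogeneous (k : Type u) [CommRing k] (M : ℤ → Type w) [∀ n, AddCommGroup (M n)]
    [∀ n, Module k (M n)] (n : ℤ) : Submodule k (⨁ n, M n) :=
  LinearMap.range (DirectSum.lof k ℤ M n)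

/-- The linear map that multiplies a homogeneous element `f` by `(-1) ^ |f|`. -/
def signMap (k : Type u) [CommRing k] (M : ℤ → Type w) [∀ n, AddCommGroup (M n)]
    [∀ n, Module k (M n)] : (⨁ n, M n) →ₗ[k] ⨁ n, M n :=
  DirectSum.toModule k ℤ _ (fun n => (n.negOnePow : ℤ) • DirectSum.lof k ℤ M n)

namespace AInfData

variable {k : Type u} [CommRing k]

/-- The total morphism module `Hom(X,Y) = ⨁ n, Hom^n(X,Y)`. -/
abbrev Tot (C : AInfData.{u, v, w} k) (X Y : C.Obj) : Type w := ⨁ n, C.Hom X Y n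

/-- The identity as an element of the total morphism module. -/
def unit (C : AInfData.{u, v, w} k) (X : C.Obj) : C.Tot X X :=
  DirectSum.lof k ℤ (C.Hom X X) 0 (C.one X)

/-- Multiply each entry `f` of a sequence by `(-1) ^ (|f| - 1)`. On a sequence `(f_n, …, f_1)` of
homogeneous entries this is multiplication by the sign `(-1) ^ (|f_n| + ⋯ + |f_1| - n)`. -/
def twist (C : AInfData.{u, v, w} k) {X Y : C.Obj} (p : CSeq C.Tot X Y) : CSeq C.Tot X Y :=
  p.map id (fun {X Y} f => -signMap k (C.Hom X Y) f)

/-- `HomogSeq C p s`: all entries of `p` are homogeneous and their degrees add up to `s`. -/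
inductive HomogSeq (C : AInfData.{u, v, w} k) : ∀ {X Y : C.Obj}, CSeq C.Tot X Y → ℤ → Prop
  | nil (X : C.Obj) : HomogSeq C (CSeq.nil X) 0
  | cons {X Y Z : C.Obj} {f : C.Tot X Y} {p : CSeq C.Tot Y Z} {a s : ℤ}
      (hf : f ∈ homogeneous k (C.Hom X Y) a) (hp : HomogSeq C p s) :
      HomogSeq C (CSeq.cons f p) (a + s)

/-- A function on composable sequences is linear in each entry. -/
structure IsMultilinear (C : AInfData.{u, v, w} k) {U : C.Obj → C.Obj → Type w'}
    [∀ X Y, AddCommGroup (U X Y)] [∀ X Y, Module k (U X Y)]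
    (φ : ∀ {X Y : C.Obj}, CSeq C.Tot X Y → U X Y) : Prop where
  map_add : ∀ {W X Y Z : C.Obj} (p : CSeq C.Tot W X) (f g : C.Tot X Y) (q : CSeq C.Tot Y Z),
    φ (p.append (CSeq.cons (f + g) q)) =
      φ (p.append (CSeq.cons f q)) + φ (p.append (CSeq.cons g q))
  map_smul : ∀ {W X Y Z : C.Obj} (p : CSeq C.Tot W X) (a : k) (f : C.Tot X Y)
    (q : CSeq C.Tot Y Z),
    φ (p.append (CSeq.cons (a • f) q)) = a • φ (p.append (CSeq.cons f q))

/-- For a function `φ` on composable sequences, the sum over all consecutive nonempty subsequences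
`∑ (-1)^‡ φ(f_d, …, f_{n+l+1}, m_l(f_{n+l}, …, f_{n+1}), f_n, …, f_1)` with the sign
`‡ = |f_n| + ⋯ + |f_1| - n`. -/
def insertSum (C : AInfData.{u, v, w} k) {U : C.Obj → C.Obj → Type w'}
    [∀ X Y, AddCommGroup (U X Y)] (φ : ∀ {X Y : C.Obj}, CSeq C.Tot X Y → U X Y)
    {X Y : C.Obj} (p : CSeq C.Tot X Y) : U X Y :=
  (p.cuts.map (fun c => (c.2.2.properCuts.map (fun e =>
    φ ((C.twist c.2.1).append (CSeq.cons (C.m e.2.1) e.2.2)))).sum)).sum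

/-- The axioms of a strictly unital `A_∞`-category. The operations `m_d` exist for `d ≥ 1`; the
value on empty sequences is zero by convention. -/
structure IsAInfCategory (C : AInfData.{u, v, w} k) : Prop where
  m_nil : ∀ X : C.Obj, C.m (CSeq.nil X) = 0
  multilinear : C.IsMultilinear (U := C.Tot) C.m
  degree : ∀ {X Y : C.Obj} (p : CSeq C.Tot X Y) (s : ℤ), C.HomogSeq p s →
    C.m p ∈ homogeneous k (C.Hom X Y) (s + 2 - p.length)
  relation : ∀ {X Y : C.Obj} (p : CSeq C.Tot X Y), C.insertSum (U := C.Tot) C.m p = 0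
  m_two_unit : ∀ {X Y : C.Obj} (f : C.Tot X Y), C.m (CSeq.pair f (C.unit X)) = f
  unit_m_two : ∀ {X Y : C.Obj} (g : C.Tot X Y),
    signMap k (C.Hom X Y) (C.m (CSeq.pair (C.unit Y) g)) = g
  m_unit : ∀ {W X Y : C.Obj} (p : CSeq C.Tot W X) (q : CSeq C.Tot X Y),
    p.length + q.length + 1 ≠ 2 → C.m (p.append (CSeq.cons (C.unit X) q)) = 0

/-- Given components `G`, all sequences `(G(p_r), …, G(p_1))` where `p_1, …, p_r` are the pieces
of a partition of `p` into `r` nonempty consecutive pieces. -/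
def blocks {C : AInfData.{u, v, w} k} {D : AInfData.{u, v, w} k} (F : C.Obj → D.Obj)
    (G : ∀ {X Y : C.Obj}, CSeq C.Tot X Y → D.Tot (F X) (F Y)) :
    ℕ → ∀ {X Y : C.Obj}, CSeq C.Tot X Y → List (CSeq D.Tot (F X) (F Y))
  | 0, _, _, CSeq.nil X => [CSeq.nil (F X)]
  | 0, _, _, CSeq.cons _ _ => []
  | r + 1, _, _, p => p.properCuts.flatMap (fun c =>
      (blocks F G r c.2.2).map (fun b => CSeq.cons (G c.2.1) b))

/-- `A_∞`-functors with map `F` on objects and components `G = {F^d}`, `F^d` being the restriction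
of `G` to sequences with `d` entries (`d ≥ 1`; the value on empty sequences is zero by
convention). -/
structure IsAInfFunctor (C D : AInfData.{u, v, w} k) (F : C.Obj → D.Obj)
    (G : ∀ {X Y : C.Obj}, CSeq C.Tot X Y → D.Tot (F X) (F Y)) : Prop where
  nil : ∀ X : C.Obj, G (CSeq.nil X) = 0
  multilinear : C.IsMultilinear (U := fun X Y => D.Tot (F X) (F Y)) G
  degree : ∀ {X Y : C.Obj} (p : CSeq C.Tot X Y) (s : ℤ), C.HomogSeq p s →
    G p ∈ homogeneous k (D.Hom (F X) (F Y)) (s + 1 - p.length)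
  relation : ∀ {X Y : C.Obj} (p : CSeq C.Tot X Y),
    ∑ r ∈ Finset.Icc 1 p.length, ((blocks F G r p).map D.m).sum =
      C.insertSum (U := fun X Y => D.Tot (F X) (F Y)) G p
  map_unit : ∀ X : C.Obj, G (CSeq.single (C.unit X)) = D.unit (F X)
  unit_zero : ∀ {W X Y : C.Obj} (p : CSeq C.Tot W X) (q : CSeq C.Tot X Y),
    2 ≤ p.length + q.length + 1 → G (p.append (CSeq.cons (C.unit X) q)) = 0

/-- The full subcategory on a set of objects, with the restricted operations. -/
def full (C : AInfData.{u, v, w} k) (s : Set C.Obj) : AInfData.{u, v, w} k where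
  Obj := s
  Hom X Y n := C.Hom X.1 Y.1 n
  m p := C.m (p.map Subtype.val (fun f => f))
  one X := C.one X.1

/-- The components of the inclusion of a full subcategory: the identity on single morphisms, zero
on longer sequences. -/
def fullIncl (C : AInfData.{u, v, w} k) (s : Set C.Obj) {X Y : (C.full s).Obj} :
    CSeq (C.full s).Tot X Y → C.Tot X.1 Y.1
  | CSeq.nil _ => 0
  | CSeq.cons f (CSeq.nil _) => f
  | CSeq.cons _ (CSeq.cons _ _) => 0

/-- The morphisms in `S` generate `C` under `k`-linear combinations and `m_2`, starting from the
identities. -/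
def IsGeneratedBy (C : AInfData.{u, v, w} k) (S : Set (Σ X Y : C.Obj, C.Tot X Y)) : Prop :=
  ∀ W : ∀ X Y : C.Obj, Submodule k (C.Tot X Y),
    (∀ X, C.unit X ∈ W X X) → (∀ f ∈ S, f.2.2 ∈ W f.1 f.2.1) →
    (∀ {X Y Z : C.Obj} (g : C.Tot Y Z) (f : C.Tot X Y), g ∈ W Y Z → f ∈ W X Y →
      C.m (CSeq.pair g f) ∈ W X Z) →
    ∀ X Y, W X Y = ⊤

end AInfData

/-! ### The dg category of a family of complexes and homotopy transfer to its cohomology -/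

section Transfer

open CochainComplex.HomComplex

variable (k : Type u) [CommRing k] {𝒞 : Type v} [Category.{w} 𝒞] [Preadditive 𝒞] [Linear k 𝒞]

/-- The cocycles of degree `n` in the complex of morphisms from `K` to `L`. -/
def cocycles (K L : CochainComplex 𝒞 ℤ) (n : ℤ) : Submodule k (Cochain K L n) :=
  LinearMap.ker (δ_hom k K L n (n + 1))

/-- The cohomology in degree `n` of the complex of morphisms from `K` to `L`. -/
abbrev HomCohomology (K L : CochainComplex 𝒞 ℤ) (n : ℤ) : Type w :=
  cocycles k K L n ⧸ (LinearMap.range (δ_hom k K L (n - 1) n)).submoduleOf (cocycles k K L n)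

/-- The cohomology class of a cocycle. -/
def cohClass {K L : CochainComplex 𝒞 ℤ} {n : ℤ} (z : Cochain K L n) (hz : δ n (n + 1) z = 0) :
    HomCohomology k K L n :=
  Submodule.Quotient.mk ⟨z, hz⟩

/-- The composition `g ∘ f` of cochains, with the sign `(-1) ^ |f|`, on total morphism modules. -/
def signedComp (K L M : CochainComplex 𝒞 ℤ) :
    (⨁ n, Cochain L M n) →ₗ[k] (⨁ n, Cochain K L n) →ₗ[k] ⨁ n, Cochain K M n :=
  DirectSum.toModule k ℤ _ (fun b => LinearMap.flip (DirectSum.toModule k ℤ _ (fun a =>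
    LinearMap.mk₂ k
      (fun (f : Cochain K L a) (g : Cochain L M b) =>
        (a.negOnePow : ℤ) • DirectSum.lof k ℤ (Cochain K M) (a + b) (f.comp g rfl))
      (fun f f' g => by rw [Cochain.add_comp, map_add, smul_add])
      (fun c f g => by rw [Cochain.smul_comp, map_smul, smul_comm])
      (fun f g g' => by rw [Cochain.comp_add, map_add, smul_add])
      (fun c f g => by rw [Cochain.comp_smul, map_smul, smul_comm]))))

variable {ι : Type w'} (K : ι → CochainComplex 𝒞 ℤ)

/-- A contraction of the dg category with objects `ι` and morphism complexes
`Hom^*(K X, K Y)` onto its cohomology: maps `i`, `p` of degree `0` and `H` of degree `-1` with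
`p i = 1`, `1 - i p = d H + H d`, `H H = 0` and `H i = 0`. Here `i` chooses a cocycle in each
cohomology class. Only the values `H X Y n m` with `m + 1 = n` matter. -/
structure Contraction where
  i : ∀ (X Y : ι) (n : ℤ), HomCohomology k (K X) (K Y) n →ₗ[k] cocycles k (K X) (K Y) n
  p : ∀ (X Y : ι) (n : ℤ), Cochain (K X) (K Y) n →ₗ[k] HomCohomology k (K X) (K Y) n
  H : ∀ (X Y : ι) (n m : ℤ), Cochain (K X) (K Y) n →ₗ[k] Cochain (K X) (K Y) m
  class_i : ∀ (X Y : ι) (n : ℤ) (x : HomCohomology k (K X) (K Y) n),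
    Submodule.Quotient.mk (i X Y n x) = x
  p_δ : ∀ (X Y : ι) (n m : ℤ), n + 1 = m → ∀ f : Cochain (K X) (K Y) n, p X Y m (δ n m f) = 0
  p_i : ∀ (X Y : ι) (n : ℤ) (x : HomCohomology k (K X) (K Y) n),
    p X Y n (i X Y n x : Cochain (K X) (K Y) n) = x
  homotopy : ∀ (X Y : ι) (l n m : ℤ), l + 1 = n → n + 1 = m → ∀ f : Cochain (K X) (K Y) n,
    f - (i X Y n (p X Y n f) : Cochain (K X) (K Y) n) =
      δ l n (H X Y n l f) + H X Y m n (δ n m f)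
  H_H : ∀ (X Y : ι) (l n m : ℤ), l + 1 = n → n + 1 = m → ∀ f : Cochain (K X) (K Y) m,
    H X Y n l (H X Y m n f) = 0
  H_i : ∀ (X Y : ι) (l n : ℤ), l + 1 = n → ∀ x : HomCohomology k (K X) (K Y) n,
    H X Y n l (i X Y n x : Cochain (K X) (K Y) n) = 0

variable {k K}

namespace Contraction

variable (c : Contraction k K)

/-- `i` on total morphism modules. -/
def iTot (X Y : ι) : (⨁ n, HomCohomology k (K X) (K Y) n) →ₗ[k] ⨁ n, Cochain (K X) (K Y) n :=
  DirectSum.toModule k ℤ _ (fun n =>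
    DirectSum.lof k ℤ (Cochain (K X) (K Y)) n ∘ₗ (cocycles k (K X) (K Y) n).subtype ∘ₗ c.i X Y n)

/-- `p` on total morphism modules. -/
def pTot (X Y : ι) : (⨁ n, Cochain (K X) (K Y) n) →ₗ[k] ⨁ n, HomCohomology k (K X) (K Y) n :=
  DirectSum.toModule k ℤ _ (fun n =>
    DirectSum.lof k ℤ (HomCohomology k (K X) (K Y)) n ∘ₗ c.p X Y n)

/-- `f ↦ (-1) ^ |f| H f` on total morphism modules. -/
def hTot (X Y : ι) : (⨁ n, Cochain (K X) (K Y) n) →ₗ[k] ⨁ n, Cochain (K X) (K Y) n :=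
  DirectSum.toModule k ℤ _ (fun n =>
    (n.negOnePow : ℤ) • (DirectSum.lof k ℤ (Cochain (K X) (K Y)) (n - 1) ∘ₗ c.H X Y n (n - 1)))

/-- The value of a tree at its outgoing edge when that edge is internal: leaves are labelled by
`i`, branch points by the (signed) composition and internal edges by the (signed) homotopy. -/
def edgeValue : ∀ {X Y : ι}, BTree (fun X Y => ⨁ n, HomCohomology k (K X) (K Y) n) X Y →
    ⨁ n, Cochain (K X) (K Y) n
  | X, Y, BTree.leaf f => c.iTot X Y f
  | _, _, BTree.node (X := X) (Y := Y) (Z := Z) l r =>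
      c.hTot X Z (signedComp k (K X) (K Y) (K Z) (edgeValue r) (edgeValue l))

/-- The operation defined by a tree: as `edgeValue`, but with the root labelled by `p`. The tree
with one leaf contributes `m_1 = 0`, the differential of the cohomology. -/
def rootValue {X Y : ι} : BTree (fun X Y => ⨁ n, HomCohomology k (K X) (K Y) n) X Y →
    ⨁ n, HomCohomology k (K X) (K Y) n
  | BTree.leaf _ => 0
  | BTree.node (X := X) (Y := Y) (Z := Z) l r =>
      c.pTot X Z (signedComp k (K X) (K Y) (K Z) (c.edgeValue r) (c.edgeValue l))

/-- The transferred `A_∞`-structure on the cohomology, `m_d = ∑ m_d^T` over planar binary trees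
with `d` leaves; the identities are the classes of the identity maps. -/
def transfer : AInfData.{u, w', w} k where
  Obj := ι
  Hom X Y n := HomCohomology k (K X) (K Y) n
  m q := (q.trees.map c.rootValue).sum
  one X := cohClass k (Cochain.ofHom (𝟙 (K X))) (by simp)

end Contraction

end Transfer

/-! ### The preprojective algebra of the `A_2` quiver, its modules and their resolutions -/

/-- The preprojective algebra of type `A_2`. The vertices are the elements of `ZMod 2` (so
vertex `1` is `1` and vertex `2` is `0`); an element has a coordinate `e i` at the trivial path `(i)`
and a coordinate `a i` at the arrow `i → i + 1`, for each vertex `i`. -/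
@[ext]
structure PiA2 (k : Type u) where
  e : ZMod 2 → k
  a : ZMod 2 → k

namespace PiA2

variable {k : Type u} [Field k]

instance : Zero (PiA2 k) := ⟨⟨0, 0⟩⟩
instance : One (PiA2 k) := ⟨⟨1, 0⟩⟩
instance : Add (PiA2 k) := ⟨fun x y => ⟨x.e + y.e, x.a + y.a⟩⟩
instance : Neg (PiA2 k) := ⟨fun x => ⟨-x.e, -x.a⟩⟩
instance : SMul k (PiA2 k) := ⟨fun c x => ⟨c • x.e, c • x.a⟩⟩
/-- In a product `x * y` of paths `y` comes first; products of two arrows vanish. -/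
instance : Mul (PiA2 k) :=
  ⟨fun x y => ⟨fun i => x.e i * y.e i, fun i => x.e (i + 1) * y.a i + x.a i * y.e i⟩⟩

@[simp] lemma zero_e (i : ZMod 2) : (0 : PiA2 k).e i = 0 := rfl
@[simp] lemma zero_a (i : ZMod 2) : (0 : PiA2 k).a i = 0 := rfl
@[simp] lemma one_e (i : ZMod 2) : (1 : PiA2 k).e i = 1 := rfl
@[simp] lemma one_a (i : ZMod 2) : (1 : PiA2 k).a i = 0 := rfl
@[simp] lemma add_e (x y : PiA2 k) (i : ZMod 2) : (x + y).e i = x.e i + y.e i := rfl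
@[simp] lemma add_a (x y : PiA2 k) (i : ZMod 2) : (x + y).a i = x.a i + y.a i := rfl
@[simp] lemma neg_e (x : PiA2 k) (i : ZMod 2) : (-x).e i = -x.e i := rfl
@[simp] lemma neg_a (x : PiA2 k) (i : ZMod 2) : (-x).a i = -x.a i := rfl
@[simp] lemma smul_e (c : k) (x : PiA2 k) (i : ZMod 2) : (c • x).e i = c * x.e i := rfl
@[simp] lemma smul_a (c : k) (x : PiA2 k) (i : ZMod 2) : (c • x).a i = c * x.a i := rfl
@[simp] lemma mul_e (x y : PiA2 k) (i : ZMod 2) : (x * y).e i = x.e i * y.e i := rfl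
@[simp] lemma mul_a (x y : PiA2 k) (i : ZMod 2) :
    (x * y).a i = x.e (i + 1) * y.a i + x.a i * y.e i := rfl

instance : Ring (PiA2 k) where
  add_assoc x y z := by ext i <;> simp [add_assoc]
  zero_add x := by ext i <;> simp
  add_zero x := by ext i <;> simp
  add_comm x y := by ext i <;> simp [add_comm]
  neg_add_cancel x := by ext i <;> simp
  mul_assoc x y z := by ext i <;> simp <;> ring
  one_mul x := by ext i <;> simp
  mul_one x := by ext i <;> simp
  left_distrib x y z := by ext i <;> simp <;> ring
  right_distrib x y z := by ext i <;> simp <;> ring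
  zero_mul x := by ext i <;> simp
  mul_zero x := by ext i <;> simp
  nsmul := nsmulRec
  zsmul := zsmulRec

instance : Module k (PiA2 k) where
  one_smul x := by ext i <;> simp
  mul_smul c d x := by ext i <;> simp [mul_assoc]
  smul_zero c := by ext i <;> simp
  smul_add c x y := by ext i <;> simp [mul_add]
  add_smul c d x := by ext i <;> simp [add_mul]
  zero_smul x := by ext i <;> simp

instance : Algebra k (PiA2 k) :=
  Algebra.ofModule (fun c x y => by ext i <;> simp <;> ring)
    (fun c x y => by ext i <;> simp <;> ring)

/-- The trivial path `(i)` at the vertex `i`. -/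
def idem (i : ZMod 2) : PiA2 k := ⟨Pi.single i 1, 0⟩

/-- The arrow `i → i + 1`. -/
def arr (i : ZMod 2) : PiA2 k := ⟨0, Pi.single i 1⟩

lemma arr_mul_arr (i j : ZMod 2) : (arr i * arr j : PiA2 k) = 0 := by
  ext l <;> simp [arr]

lemma idem_mul_idem (i : ZMod 2) : (idem i * idem i : PiA2 k) = idem i := by
  ext l <;> simp [idem, Pi.single_apply]

lemma arr_mul_idem (i : ZMod 2) : (arr i * idem i : PiA2 k) = arr i := by
  ext l <;> simp [idem, arr, Pi.single_apply]

variable (k)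

/-- The projective module `P_i`, the left ideal generated by `(i)`. -/
def proj (i : ZMod 2) : Submodule (PiA2 k) (PiA2 k) := Submodule.span (PiA2 k) {idem i}

variable {k}

lemma mem_proj (i : ZMod 2) (x : PiA2 k) : x ∈ proj k i ↔ x * idem i = x := by
  rw [proj, Submodule.mem_span_singleton]
  constructor
  · rintro ⟨y, rfl⟩
    rw [smul_eq_mul, mul_assoc, idem_mul_idem]
  · intro h
    exact ⟨x, h⟩

instance (i : ZMod 2) : Module.Projective (PiA2 k) (proj k i) :=
  Module.Projective.of_split (proj k i).subtype
    ((LinearMap.toSpanSingleton (PiA2 k) (PiA2 k) (idem i)).codRestrict _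
      (fun x => by
        rw [mem_proj, LinearMap.toSpanSingleton_apply, smul_eq_mul, mul_assoc, idem_mul_idem]))
    (LinearMap.ext fun x => Subtype.ext ((mem_proj i x.1).1 x.2))

end PiA2

/-- The objects of the preprojective category: the four indecomposable modules `S_1`, `S_2`
(simple) and `P_1`, `P_2` (projective). -/
inductive PObj : Type
  | S (i : ZMod 2)
  | P (i : ZMod 2)

namespace PObj

open PiA2

variable (k : Type u) [Field k]

/-- The terms of the complexes of projectives that represent the four modules. For `P_i` it is
`P_i` in degree `0`. For `S_i` it is the resolution `⋯ → P_i → P_{i+1} → P_i`, with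
`P_{i+n}` in degree `n ≤ 0`. -/
def term : PObj → ℤ → Submodule (PiA2 k) (PiA2 k)
  | S i, n => if n ≤ 0 then proj k (i + n) else ⊥
  | P i, n => if n = 0 then proj k i else ⊥

/-- The differential `P_{i+n} → P_{i+n+1}` of the resolution of `S_i` is right multiplication by
the arrow `i+n+1 → i+n`; this is the element by which one has to multiply. -/
def dElt : PObj → ℤ → ℤ → PiA2 k
  | S i, n, m => if n + 1 = m ∧ m ≤ 0 then arr (i + m) else 0
  | P _, _, _ => 0

variable {k}

lemma mul_dElt_mem (X : PObj) (n m : ℤ) (x : PiA2 k) : x * dElt k X n m ∈ term k X m := by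
  cases X with
  | P i => simp [dElt]
  | S i =>
    by_cases h : n + 1 = m ∧ m ≤ 0
    · simp only [dElt, term, if_pos h, if_pos h.2, mem_proj, mul_assoc, arr_mul_idem]
    · simp [dElt, if_neg h]

lemma dElt_mul_dElt (X : PObj) (n m l : ℤ) : dElt k X n m * dElt k X m l = 0 := by
  cases X with
  | P i => simp [dElt]
  | S i => simp only [dElt]; split_ifs <;> simp [arr_mul_arr]

/-- Right multiplication by an element of the algebra, between submodules of the algebra. -/
def rightMul (A B : Submodule (PiA2 k) (PiA2 k)) (y : PiA2 k) (h : ∀ x ∈ A, x * y ∈ B) :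
    ModuleCat.of (PiA2 k) A ⟶ ModuleCat.of (PiA2 k) B :=
  ModuleCat.ofHom ((LinearMap.toSpanSingleton (PiA2 k) (PiA2 k) y).restrict h)

lemma rightMul_apply {A B : Submodule (PiA2 k) (PiA2 k)} {y : PiA2 k} {h : ∀ x ∈ A, x * y ∈ B}
    (x : A) : (((rightMul A B y h).hom x : B) : PiA2 k) = x * y := rfl

variable (k)

/-- The complex of projectives that represents an indecomposable module. -/
def cpx (X : PObj) : CochainComplex (ModuleCat.{u} (PiA2 k)) ℤ where
  X n := ModuleCat.of (PiA2 k) (term k X n)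
  d n m := rightMul _ _ (dElt k X n m) (fun x _ => mul_dElt_mem X n m x)
  shape n m h := by
    have h0 : dElt k X n m = 0 := by
      cases X with
      | P i => rfl
      | S i => exact if_neg (fun h' => h h'.1)
    refine ModuleCat.hom_ext (LinearMap.ext fun x => Subtype.ext ?_)
    change (x : PiA2 k) * dElt k X n m = 0
    rw [h0, mul_zero]
  d_comp_d' n m l _ _ := by
    refine ModuleCat.hom_ext (LinearMap.ext fun x => Subtype.ext ?_)
    change (x : PiA2 k) * dElt k X n m * dElt k X m l = 0
    rw [mul_assoc, dElt_mul_dElt, mul_zero]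

variable {k}

/-- The complex of `S_i` is exact in negative degrees. -/
lemma exact_neg (i : ZMod 2) (n : ℤ) (hn : n < 0) (x : PiA2 k) (hx : x ∈ term k (S i) n)
    (h : x * dElt k (S i) n (n + 1) = 0) :
    ∃ y ∈ term k (S i) (n - 1), y * dElt k (S i) (n - 1) n = x := by
  rw [term, if_pos hn.le, mem_proj] at hx
  rw [dElt, if_pos ⟨rfl, by lia⟩] at h
  have h2 : ∀ l : ZMod 2, l + 1 + 1 = l := by decide
  have h3 : ∀ l m : ZMod 2, l ≠ m → l = m + 1 := by decide
  have hc : ((n - 1 : ℤ) : ZMod 2) = n + 1 := by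
    push_cast; generalize (n : ZMod 2) = t; revert t; decide
  have hc' : ((n + 1 : ℤ) : ZMod 2) = n + 1 := by push_cast; rfl
  refine ⟨x.a (i + n) • idem (i + n + 1), ?_, ?_⟩
  · rw [term, if_pos (by lia), mem_proj, hc, ← add_assoc, smul_mul_assoc, idem_mul_idem]
  · rw [dElt, if_pos ⟨by lia, hn.le⟩]
    have he : x.e (i + n) = 0 := by
      have := congrArg (fun z => a z (i + n + 1)) h
      simpa [arr, hc', ← add_assoc, h2] using this
    rw [← hx]
    ext l <;> by_cases hl : l = i + n <;> simp [idem, arr, Pi.single_apply, hl, he]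

/-- In degree zero the image of the differential of the complex of `S_i` is the kernel of
`P_i → S_i`, where `S_i` is `k` with `x` acting as multiplication by `x.e i`. -/
lemma exact_zero (i : ZMod 2) (x : PiA2 k) (hx : x ∈ term k (S i) 0) :
    (∃ y ∈ term k (S i) (-1), y * dElt k (S i) (-1) 0 = x) ↔ x.e i = 0 := by
  rw [term, if_pos le_rfl, mem_proj, Int.cast_zero, add_zero] at hx
  rw [dElt, if_pos ⟨by lia, le_rfl⟩, term, if_pos (by lia), Int.cast_zero, add_zero]
  constructor
  · rintro ⟨y, -, rfl⟩
    simp [arr]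
  · intro h
    refine ⟨x.a i • idem (i + ((-1 : ℤ) : ZMod 2)), ?_, ?_⟩
    · rw [mem_proj, smul_mul_assoc, idem_mul_idem]
    · have hc : ((-1 : ℤ) : ZMod 2) = 1 := by decide
      rw [← hx]
      ext l <;> by_cases hl : l = i <;> simp [idem, arr, Pi.single_apply, hl, h, hc]

/-- The element `(-1) ^ m (i + m)`, or zero when `m > 0`. -/
def extElt (k : Type u) [Field k] (i : ZMod 2) (m : ℤ) : PiA2 k :=
  if m ≤ 0 then (m.negOnePow : ℤ) • idem (i + m) else 0

lemma mul_extElt_mem (i : ZMod 2) (m : ℤ) (x : PiA2 k) : x * extElt k i m ∈ term k (S i) m := by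
  by_cases h : m ≤ 0
  · simp only [extElt, term, if_pos h, mem_proj, mul_assoc, smul_mul_assoc, idem_mul_idem]
  · simp [extElt, if_neg h]

open CochainComplex.HomComplex

/-- The map of degree `1` from the resolution of `S_j` to that of `S_i` whose component into
degree `m ≤ 0` is right multiplication by `(-1) ^ m (i + m)`. For `j = i + 1` this component is
`(-1) ^ m` times the identity of `P_{i+m}`. -/
def extCochain (k : Type u) [Field k] (j i : ZMod 2) : Cochain (cpx k (S j)) (cpx k (S i)) 1 :=
  Cochain.mk (fun _ m _ => rightMul _ _ (extElt k i m) (fun x _ => mul_extElt_mem i m x))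

lemma idem_arr_comm (j i t : ZMod 2) :
    (idem (j + t) * (idem (i + t + 1) * arr (i + t)) : PiA2 k) =
      idem (j + t) * (arr (j + t + 1) * idem (i + t)) := by
  have h2 : ∀ l : ZMod 2, l + 1 + 1 = l := by decide
  have h3 : j = i ∨ j = i + 1 := by revert i j; decide
  have h4 : ∀ l : ZMod 2, l ≠ l + 1 := by decide
  rcases h3 with rfl | rfl
  · ext l
    · simp [idem, arr]
    · simp only [idem, arr, mul_a, mul_e, Pi.single_apply, Pi.zero_apply, add_left_inj]
      split_ifs <;> simp_all
  · rw [add_right_comm i 1 t, h2]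
    ext l
    · simp [idem, arr]
    · simp only [idem, arr, mul_a, mul_e, Pi.single_apply, Pi.zero_apply, add_left_inj]
      split_ifs <;> simp_all

lemma δ_extCochain (j i : ZMod 2) : δ 1 (1 + 1) (extCochain k j i) = 0 := by
  ext n m hnm : 1
  rw [δ_v 1 (1 + 1) rfl _ n m hnm (n + 1) (n + 1) (by lia) rfl]
  rw [show (1 + 1 : ℤ).negOnePow = 1 from rfl, one_smul]
  refine ModuleCat.hom_ext (LinearMap.ext fun ⟨x, h⟩ => Subtype.ext ?_)
  change x * extElt k i (n + 1) * dElt k (S i) (n + 1) m +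
    x * dElt k (S j) n (n + 1) * extElt k i m = 0
  by_cases hm : m ≤ 0
  · obtain rfl : m = n + 1 + 1 := by lia
    have hx : x * idem (j + n) = x := by
      rw [term, if_pos (by lia), mem_proj] at h
      exact h
    have h2 : ∀ l : ZMod 2, l + 1 + 1 = l := by decide
    simp only [extElt, dElt, if_pos hm, if_pos (show n + 1 ≤ 0 by lia), true_and, Int.cast_add,
      Int.cast_one, Int.negOnePow_succ, Units.val_neg, neg_smul, mul_neg, neg_neg, neg_mul,
      mul_smul_comm, smul_mul_assoc, ← add_assoc, h2]
    rw [neg_add_eq_zero, mul_assoc, mul_assoc, ← hx, mul_assoc, mul_assoc x,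
      idem_arr_comm]
  · simp [extElt, dElt, hm]

/-- The class in `Ext^1(S_j, S_i)`, for `j = i + 1`, of the short exact sequence
`0 → S_i → P_j → S_j → 0`. -/
def extClass (k : Type u) [Field k] (j i : ZMod 2) :
    HomCohomology k (cpx k (S j)) (cpx k (S i)) 1 :=
  cohClass k (extCochain k j i) (δ_extCochain (k := k) j i)

end PObj

/-! ### The preprojective category and its subcategory of simples -/

section Preprojective

open PObj

variable {k : Type u} [Field k]

/-- The preprojective category: the `Ext`-algebra of the sum of the four indecomposable modules
with the `A_∞`-structure transferred along a contraction `c`. -/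
def preproj (c : Contraction k (cpx k)) : AInfData.{u, 0, u} k := c.transfer

/-- The full subcategory on the simple modules. -/
def simples (c : Contraction k (cpx k)) : AInfData.{u, 0, u} k :=
  (preproj c).full {X : PObj | ∃ i, X = PObj.S i}

/-- The simple module `S_i` as an object of the subcategory of simples. -/
def simple (c : Contraction k (cpx k)) (i : ZMod 2) : (simples c).Obj := ⟨PObj.S i, i, rfl⟩

/-- `α : S_2 → S_1`, of degree `1`. -/
def alpha (c : Contraction k (cpx k)) : (simples c).Tot (simple c 2) (simple c 1) :=
  DirectSum.lof k ℤ ((simples c).Hom (simple c 2) (simple c 1)) 1 (extClass k 2 1)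

/-- `β : S_1 → S_2`, of degree `1`. -/
def beta (c : Contraction k (cpx k)) : (simples c).Tot (simple c 1) (simple c 2) :=
  DirectSum.lof k ℤ ((simples c).Hom (simple c 1) (simple c 2)) 1 (extClass k 1 2)

/-- The components of the inclusion of the simples into the preprojective category. -/
def incl (c : Contraction k (cpx k)) {X Y : (simples c).Obj} :
    CSeq (simples c).Tot X Y → (preproj c).Tot X.1 Y.1 :=
  (preproj c).fullIncl {X : PObj | ∃ i, X = PObj.S i}

end Preprojective

end

noncomputable section

/-!
A contraction that maps the class of each identity morphism to the identity transfers the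
dg structure to a strictly unital `A_∞`-structure on cohomology: the sums over trees with outgoing
internal edge are the components of an `A_∞`-functor into the dg category, and the defects in its
equations vanish by induction on the length of the sequence.

In the complex of morphisms from the resolution of `S_j` to that of `S_i` there are no coboundaries
in the degrees `n` with `j = i + n`, and there is no cohomology in the other degrees. The
representatives of `Ext`-classes between simple modules are therefore forced, and they are closed
under composition. Since `H` kills representatives, every tree with more than two leaves contributes
zero. Moreover `Ext^n(S_j, S_i)` is spanned for `j = i + n` by the class of a shift, which is up to
sign a product of `n` shifts of degree one, so `α` and `β` generate. Two strict functors that agree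
on generators agree.
-/

/-! ### Cuts and insertions -/

namespace CSeq

variable {Obj : Type v} {T : Obj → Obj → Type w} {Obj' : Type w'} {T' : Obj' → Obj' → Type w}
  {W X Y Z : Obj}

@[simp] lemma append_nil (p : CSeq T X Y) : p.append (nil Y) = p := by
  induction p with
  | nil X => rfl
  | cons f p ih => rw [append, ih]

@[simp] lemma length_append (p : CSeq T X Y) (q : CSeq T Y Z) :
    (p.append q).length = p.length + q.length := by
  induction p with
  | nil X => simp only [append, length, zero_add]
  | cons f p ih => simp only [append, length, ih]; omega

@[simp] lemma length_map (F : Obj → Obj') (φ : ∀ {X Y : Obj}, T X Y → T' (F X) (F Y))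
    (p : CSeq T X Z) : (p.map F φ).length = p.length := by
  induction p with
  | nil X => rfl
  | cons f p ih => simp only [map, length, ih]

lemma map_append (F : Obj → Obj') (φ : ∀ {X Y : Obj}, T X Y → T' (F X) (F Y)) (p : CSeq T X Y)
    (q : CSeq T Y Z) : (p.append q).map F φ = (p.map F φ).append (q.map F φ) := by
  induction p with
  | nil X => rfl
  | cons f p ih => simp only [map, append, ih]

lemma append_of_mem_cuts (p : CSeq T X Z) : ∀ c ∈ p.cuts, c.2.1.append c.2.2 = p := by
  induction p with
  | nil X => simp [cuts, append]
  | cons f p ih =>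
    intro c hc
    simp only [cuts, List.mem_cons, List.mem_map] at hc
    obtain rfl | ⟨d, hd, rfl⟩ := hc
    · rfl
    · exact congrArg (cons f) (ih d hd)

variable {A B G : Type*} [AddCommMonoid A] [AddCommMonoid B] [FunLike G A B]
  [AddMonoidHomClass G A B]

/-- The sum of a function over all ways of cutting a sequence into two consecutive, possibly empty,
pieces. -/
def cutSum (ψ : ∀ Y, CSeq T X Y → CSeq T Y Z → A) (p : CSeq T X Z) : A :=
  (p.cuts.map (fun c => ψ c.1 c.2.1 c.2.2)).sum

@[simp] lemma cutSum_nil (ψ : ∀ Y, CSeq T X Y → CSeq T Y X → A) :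
    cutSum ψ (nil X) = ψ X (nil X) (nil X) := by
  simp [cutSum, cuts]

lemma cutSum_cons (ψ : ∀ Y, CSeq T X Y → CSeq T Y Z → A) (f : T X Y) (p : CSeq T Y Z) :
    cutSum ψ (cons f p) = ψ X (nil X) (cons f p) + cutSum (fun W a b => ψ W (cons f a) b) p := by
  simp [cutSum, cuts, Function.comp_def]

lemma cutSum_congr {ψ ψ' : ∀ Y, CSeq T X Y → CSeq T Y Z → A} (p : CSeq T X Z)
    (h : ∀ Y a b, a.append b = p → ψ Y a b = ψ' Y a b) : cutSum ψ p = cutSum ψ' p :=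
  congrArg List.sum (List.map_congr_left fun c hc => h _ _ _ (append_of_mem_cuts p c hc))

lemma cutSum_congr_of_lt {ψ ψ' : ∀ Y, CSeq T X Y → CSeq T Y Z → A} (p : CSeq T X Z)
    (hl : ψ X (nil X) p = ψ' X (nil X) p) (hr : ψ Z p (nil Z) = ψ' Z p (nil Z))
    (h : ∀ Y a b, a.length < p.length → b.length < p.length → ψ Y a b = ψ' Y a b) :
    cutSum ψ p = cutSum ψ' p := by
  refine cutSum_congr p fun Y a b hab => ?_
  cases a with
  | nil =>
    obtain rfl : b = p := hab
    exact hl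
  | cons f a =>
    cases b with
    | nil =>
      obtain rfl : cons f a = p := (append_nil _).symm.trans hab
      exact hr
    | cons g b => exact h _ _ _ (by simp [← hab, length]) (by simp [← hab, length])

@[simp] lemma cutSum_zero (p : CSeq T X Z) : cutSum (fun _ _ _ => (0 : A)) p = 0 := by
  simp [cutSum]

lemma cutSum_eq_zero (ψ : ∀ Y, CSeq T X Y → CSeq T Y Z → A) (p : CSeq T X Z)
    (h : ∀ Y a b, append a b = p → ψ Y a b = 0) : cutSum ψ p = 0 :=
  (cutSum_congr p h).trans (cutSum_zero p)

lemma cutSum_add (ψ ψ' : ∀ Y, CSeq T X Y → CSeq T Y Z → A) (p : CSeq T X Z) :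
    cutSum (fun Y a b => ψ Y a b + ψ' Y a b) p = cutSum ψ p + cutSum ψ' p :=
  List.sum_map_add

lemma cutSum_sub {D : Type*} [AddCommGroup D] (ψ ψ' : ∀ Y, CSeq T X Y → CSeq T Y Z → D)
    (p : CSeq T X Z) : cutSum (fun Y a b => ψ Y a b - ψ' Y a b) p = cutSum ψ p - cutSum ψ' p := by
  induction p with
  | nil X => simp
  | cons f p ih =>
    simp only [cutSum_cons, ih]
    abel

lemma map_cutSum (g : G) (ψ : ∀ Y, CSeq T X Y → CSeq T Y Z → A) (p : CSeq T X Z) :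
    g (cutSum ψ p) = cutSum (fun Y a b => g (ψ Y a b)) p := by
  simp [cutSum, map_list_sum, Function.comp_def]

lemma cutSum_mem {S : Type*} [SetLike S A] [AddSubmonoidClass S A] (s : S)
    (ψ : ∀ Y, CSeq T X Y → CSeq T Y Z → A) (p : CSeq T X Z)
    (h : ∀ Y a b, a.append b = p → ψ Y a b ∈ s) : cutSum ψ p ∈ s :=
  list_sum_mem (List.forall_mem_map.2 fun c hc => h _ _ _ (append_of_mem_cuts p c hc))

/-- Coassociativity of cutting: both sides sum over the ways of cutting into three pieces. -/
lemma cutSum_cutSum (ψ : ∀ Y W, CSeq T X Y → CSeq T Y W → CSeq T W Z → A) (p : CSeq T X Z) :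
    cutSum (fun Y a r => cutSum (fun W b c => ψ Y W a b c) r) p =
      cutSum (fun W l c => cutSum (fun Y a b => ψ Y W a b c) l) p := by
  induction p with
  | nil X => simp
  | cons f p ih => simp only [cutSum_cons, cutSum_nil, cutSum_add, ih, add_assoc]

lemma cutSum_append_cons (ψ : ∀ Y, CSeq T W Y → CSeq T Y Z → A) (p : CSeq T W X) (f : T X Y)
    (q : CSeq T Y Z) :
    cutSum ψ (p.append (cons f q)) =
      cutSum (fun V a b => ψ V a (b.append (cons f q))) p +
        cutSum (fun V a b => ψ V (p.append (cons f a)) b) q := by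
  induction p with
  | nil X => simp [append, cutSum_cons]
  | cons g p ih => simp only [append, cutSum_cons, ih, add_assoc]

lemma cutSum_eq_nil_left (ψ : ∀ Y, CSeq T X Y → CSeq T Y Z → A) (p : CSeq T X Z)
    (h : ∀ Y a b, append a b = p → 1 ≤ length a → ψ Y a b = 0) : cutSum ψ p = ψ X (nil X) p := by
  cases p with
  | nil X => exact cutSum_nil ψ
  | cons f p =>
    have h_cons : cutSum (fun Y a b => ψ Y (cons f a) b) p = 0 :=
      cutSum_eq_zero _ p fun Y a b hab =>
        h Y (cons f a) b (by rw [append, hab]) (Nat.le_add_left 1 _)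
    rw [cutSum_cons, h_cons, add_zero]

lemma cutSum_eq_nil_right (ψ : ∀ Y, CSeq T X Y → CSeq T Y Z → A) (p : CSeq T X Z)
    (h : ∀ Y a b, append a b = p → 1 ≤ length b → ψ Y a b = 0) : cutSum ψ p = ψ Z p (nil Z) := by
  induction p with
  | nil X => exact cutSum_nil ψ
  | cons f p ih =>
    rw [cutSum_cons, h _ _ _ rfl (by simp [length]), zero_add,
      ih _ fun Y a b hab hb => h Y (cons f a) b (by rw [append, hab]) hb]

lemma cutSum_map (F : Obj → Obj') (φ : ∀ {X Y : Obj}, T X Y → T' (F X) (F Y))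
    (ψ : ∀ Y, CSeq T' (F X) Y → CSeq T' Y (F Z) → A) (p : CSeq T X Z) :
    cutSum ψ (p.map F φ) = cutSum (fun Y a b => ψ (F Y) (a.map F φ) (b.map F φ)) p := by
  induction p with
  | nil X => simp [map]
  | cons f p ih => simp only [map, cutSum_cons, ih]

variable (m : ∀ {X Y : Obj}, CSeq T X Y → T X Y) (σ : ∀ {X Y : Obj}, T X Y → T X Y)

/-- The sum over all ways of replacing a nonempty consecutive subsequence by its value under `m`,
where `σ` is applied to the entries before that subsequence. For the operations of `C : AInfData k`
this is `AInfData.insertSum`, but here the endpoints are fixed. -/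
def ins (φ : CSeq T X Y → A) (p : CSeq T X Y) : A :=
  (p.cuts.map (fun c => (c.2.2.properCuts.map (fun e =>
    φ ((c.2.1.map id σ).append (CSeq.cons (m e.2.1) e.2.2)))).sum)).sum

@[simp] lemma ins_nil (φ : CSeq T X X → A) : ins m σ φ (nil X) = 0 := by
  simp [ins, cuts, properCuts]

lemma ins_cons (φ : CSeq T X Z → A) (f : T X Y) (p : CSeq T Y Z) :
    ins m σ φ (cons f p) = cutSum (fun _ b c => φ (cons (m (cons f b)) c)) p +
      ins m σ (fun q => φ (cons (σ f) q)) p := by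
  simp only [ins, cuts, List.map_cons, List.sum_cons, List.map_map, properCuts, cutSum]
  rfl

lemma ins_add (φ φ' : CSeq T X Y → A) (p : CSeq T X Y) :
    ins m σ (fun q => φ q + φ' q) p = ins m σ φ p + ins m σ φ' p := by
  simp only [ins, List.sum_map_add]

lemma map_ins (g : G) (φ : CSeq T X Y → A) (p : CSeq T X Y) :
    g (ins m σ φ p) = ins m σ (fun q => g (φ q)) p := by
  simp [ins, map_list_sum, Function.comp_def]

lemma ins_eq_zero (φ : CSeq T X Y → A) (h : ∀ q, 1 ≤ q.length → φ q = 0) (p : CSeq T X Y) :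
    ins m σ φ p = 0 := by
  have h_insert {V W : Obj} (a : CSeq T X V) (f : T V W) (b : CSeq T W Y) :
      φ (a.append (cons f b)) = 0 := h _ (by simp only [length_append, length]; omega)
  simp [ins, h_insert]

lemma ins_eq_single (φ : CSeq T X Y → A) (h : ∀ q, 2 ≤ q.length → φ q = 0) (p : CSeq T X Y)
    (hp : 1 ≤ p.length) : ins m σ φ p = φ (single (m p)) := by
  cases p with
  | nil X => simp [length] at hp
  | cons f p =>
    rw [ins_cons, ins_eq_zero _ _ _ fun q hq => h _ (by simpa [length] using hq), add_zero]
    exact cutSum_eq_nil_right _ p fun _ _ b _ hb => h _ (by simpa [length] using hb)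

/-- `ins` is a coderivation: a cut is either before or after the inserted entry. -/
lemma ins_cutSum (ψ : ∀ Y, CSeq T X Y → CSeq T Y Z → A) (p : CSeq T X Z) :
    ins m σ (cutSum ψ) p = cutSum (fun Y l r => ins m σ (fun a => ψ Y a r) l +
      ins m σ (fun b => ψ Y (l.map id σ) b) r) p := by
  induction p with
  | nil X => simp
  | cons f p ih =>
    rw [ins_cons]
    simp only [cutSum_cons, ins_add, ih, cutSum_add, ins_nil, ins_cons, map, id, cutSum_cutSum]
    abel

lemma ins_map (F : Obj → Obj') (τ : ∀ {X Y : Obj}, T X Y → T' (F X) (F Y))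
    (m' : ∀ {X Y : Obj'}, CSeq T' X Y → T' X Y) (σ' : ∀ {X Y : Obj'}, T' X Y → T' X Y)
    (hm : ∀ {X Y : Obj} (p : CSeq T X Y), m' (p.map F τ) = τ (m p))
    (hσ : ∀ {X Y : Obj} (f : T X Y), σ' (τ f) = τ (σ f)) (φ : CSeq T' (F X) (F Y) → A)
    (p : CSeq T X Y) : ins m' σ' φ (p.map F τ) = ins m σ (fun q => φ (q.map F τ)) p := by
  induction p with
  | nil X => simp [map]
  | cons f p ih =>
    have hm_cons {Y' : Obj} (b : CSeq T _ Y') :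
        m' (cons (τ f) (b.map F τ)) = τ (m (cons f b)) := hm (cons f b)
    simp only [map, ins_cons, cutSum_map, ih, hσ, hm_cons]

end CSeq

/-! ### Total morphism modules -/

section Graded

variable {k : Type u} [CommRing k] {M : ℤ → Type w} [∀ n, AddCommGroup (M n)] [∀ n, Module k (M n)]

lemma linearMap_congr_of_lof {P : Type*} [AddCommMonoid P] [Module k P]
    {F G : (⨁ n, M n) →ₗ[k] P} (h : ∀ n x, F (lof k ℤ M n x) = G (lof k ℤ M n x))
    (x : ⨁ n, M n) : F x = G x :=
  LinearMap.congr_fun (DirectSum.linearMap_ext k fun n => LinearMap.ext (h n)) x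

lemma linearMap_congr_of_lof₂ {N : ℤ → Type w'} [∀ n, AddCommGroup (N n)] [∀ n, Module k (N n)]
    {P : Type*} [AddCommMonoid P] [Module k P] {F G : (⨁ n, M n) →ₗ[k] (⨁ n, N n) →ₗ[k] P}
    (h : ∀ n x m y, F (lof k ℤ M n x) (lof k ℤ N m y) = G (lof k ℤ M n x) (lof k ℤ N m y))
    (x : ⨁ n, M n) (y : ⨁ n, N n) : F x y = G x y :=
  LinearMap.congr_fun
    (linearMap_congr_of_lof (fun n x => LinearMap.ext (linearMap_congr_of_lof (h n x))) x) y

@[simp] lemma signMap_lof (n : ℤ) (x : M n) :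
    signMap k M (lof k ℤ M n x) = (n.negOnePow : ℤ) • lof k ℤ M n x := by
  simp [signMap]

@[simp] lemma signMap_signMap (x : ⨁ n, M n) : signMap k M (signMap k M x) = x := by
  refine linearMap_congr_of_lof (F := signMap k M ∘ₗ signMap k M) (G := LinearMap.id)
    (fun n x => ?_) x
  simp only [LinearMap.comp_apply, signMap_lof, map_zsmul, smul_smul, Int.units_coe_mul_self,
    one_smul, LinearMap.id_apply]

lemma lof_mem_homogeneous (n : ℤ) (x : M n) : lof k ℤ M n x ∈ homogeneous k M n :=
  LinearMap.mem_range_self _ x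

end Graded

section DgTotal

open CochainComplex.HomComplex

variable {k : Type u} [CommRing k] {𝒞 : Type v} [Category.{w} 𝒞] [Preadditive 𝒞] [Linear k 𝒞]
  {K L M N : CochainComplex 𝒞 ℤ}

lemma signedComp_lof {a b c : ℤ} (h : a + b = c) (g : Cochain L M b) (f : Cochain K L a) :
    signedComp k K L M (lof k ℤ (Cochain L M) b g) (lof k ℤ (Cochain K L) a f) =
      (a.negOnePow : ℤ) • lof k ℤ (Cochain K M) c (f.comp g h) := by
  subst h
  simp [signedComp]

variable (k K L) in
/-- The differential `f ↦ (-1) ^ |f| d f` on total morphism modules. With this sign and that of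
`signedComp` the dg category is an `A_∞`-category without operations of more than two inputs. -/
def dTot : (⨁ n, Cochain K L n) →ₗ[k] ⨁ n, Cochain K L n :=
  DirectSum.toModule k ℤ _ (fun n =>
    (n.negOnePow : ℤ) • (DirectSum.lof k ℤ (Cochain K L) (n + 1) ∘ₗ δ_hom k K L n (n + 1)))

lemma dTot_lof {n m : ℤ} (h : n + 1 = m) (f : Cochain K L n) :
    dTot k K L (lof k ℤ (Cochain K L) n f) =
      (n.negOnePow : ℤ) • lof k ℤ (Cochain K L) m (δ n m f) := by
  subst h
  simp [dTot]

lemma dTot_signedComp (g : ⨁ n, Cochain L M n) (f : ⨁ n, Cochain K L n) :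
    dTot k K M (signedComp k K L M g f) =
      signedComp k K L M (dTot k L M g) (signMap k _ f) - signedComp k K L M g (dTot k K L f) := by
  refine linearMap_congr_of_lof₂ (F := (signedComp k K L M).compr₂ (dTot k K M))
    (G := (signedComp k K L M ∘ₗ dTot k L M).compl₂ (signMap k (Cochain K L)) -
      (signedComp k K L M).compl₂ (dTot k K L)) (fun b g a f => ?_) g f
  have hd : δ (a + b) (a + b + 1) (f.comp g rfl) =
      f.comp (δ b (b + 1) g) (add_assoc a b 1).symm +
        (b.negOnePow : ℤ) • (δ a (a + 1) f).comp g (add_right_comm a 1 b) :=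
    δ_comp f g rfl (a + 1) (b + 1) (a + b + 1) rfl rfl rfl
  simp only [LinearMap.compr₂_apply, LinearMap.sub_apply, LinearMap.compl₂_apply,
    LinearMap.comp_apply, LinearMap.smul_apply, map_zsmul, map_add, signMap_lof, dTot_lof rfl, hd,
    signedComp_lof (Eq.refl (a + b)), signedComp_lof (add_right_comm a 1 b),
    signedComp_lof (add_assoc a b 1).symm, smul_add, smul_smul]
  have ha := Int.units_coe_mul_self a.negOnePow
  have hb := Int.units_coe_mul_self b.negOnePow
  simp only [Int.negOnePow_add, Int.negOnePow_one, Units.val_mul, Units.val_neg, Units.val_one,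
    mul_comm (b.negOnePow : ℤ) a.negOnePow, ← mul_assoc, ha, hb, one_mul, one_smul, neg_smul,
    sub_neg_eq_add]

lemma signedComp_assoc (h : ⨁ n, Cochain M N n) (g : ⨁ n, Cochain L M n)
    (f : ⨁ n, Cochain K L n) :
    signedComp k K M N h (signedComp k K L M g f) =
      signedComp k K L N (signedComp k L M N h g) (signMap k (Cochain K L) f) := by
  refine linearMap_congr_of_lof₂
    (F := (signedComp k K M N).compl₂ ((signedComp k K L M).flip f))
    (G := (signedComp k L M N).compr₂ ((signedComp k K L N).flip (signMap k (Cochain K L) f)))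
    (fun c h b g => ?_) h g
  refine linearMap_congr_of_lof
    (F := signedComp k K M N (lof k ℤ _ c h) ∘ₗ signedComp k K L M (lof k ℤ _ b g))
    (G := signedComp k K L N (signedComp k L M N (lof k ℤ _ c h) (lof k ℤ _ b g)) ∘ₗ
      signMap k (Cochain K L)) (fun a f => ?_) f
  simp only [LinearMap.comp_apply, LinearMap.smul_apply, signMap_lof, map_zsmul,
    signedComp_lof (Eq.refl (a + b)), signedComp_lof (Eq.refl (b + c)),
    signedComp_lof (Eq.refl (a + b + c)), signedComp_lof (add_assoc a b c).symm,
    Cochain.comp_assoc f g h rfl rfl rfl, smul_smul, Int.negOnePow_add, Units.val_mul]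
  congr 1
  ring

lemma signMap_signedComp (g : ⨁ n, Cochain L M n) (f : ⨁ n, Cochain K L n) :
    signMap k (Cochain K M) (signedComp k K L M g f) =
      signedComp k K L M (signMap k (Cochain L M) g) (signMap k (Cochain K L) f) := by
  refine linearMap_congr_of_lof₂ (F := (signedComp k K L M).compr₂ (signMap k (Cochain K M)))
    (G := (signedComp k K L M).compl₁₂ (signMap k (Cochain L M)) (signMap k (Cochain K L)))
    (fun b g a f => ?_) g f
  simp only [LinearMap.compr₂_apply, LinearMap.compl₁₂_apply, signedComp_lof rfl, signMap_lof,
    map_zsmul, LinearMap.smul_apply, smul_smul, Int.negOnePow_add, Units.val_mul]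
  congr 1
  ring

lemma signedComp_mem_homogeneous {a b : ℤ} {g : ⨁ n, Cochain L M n} {f : ⨁ n, Cochain K L n}
    (hg : g ∈ homogeneous k (Cochain L M) b) (hf : f ∈ homogeneous k (Cochain K L) a) :
    signedComp k K L M g f ∈ homogeneous k (Cochain K M) (a + b) := by
  obtain ⟨g, rfl⟩ := hg
  obtain ⟨f, rfl⟩ := hf
  rw [signedComp_lof rfl]
  exact zsmul_mem (lof_mem_homogeneous _ _) _

lemma signedComp_id (g : ⨁ n, Cochain K L n) :
    signedComp k K K L g (lof k ℤ (Cochain K K) 0 (Cochain.ofHom (𝟙 K))) = g := by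
  refine linearMap_congr_of_lof (F := (signedComp k K K L).flip _) (G := LinearMap.id)
    (fun b g => ?_) g
  simp [signedComp_lof (zero_add b)]

lemma id_signedComp (f : ⨁ n, Cochain K L n) :
    signedComp k K L L (lof k ℤ (Cochain L L) 0 (Cochain.ofHom (𝟙 L))) f =
      signMap k (Cochain K L) f := by
  refine linearMap_congr_of_lof (fun a f => ?_) f
  rw [signedComp_lof (add_zero a), Cochain.comp_id, signMap_lof]

end DgTotal

namespace Contraction

open CochainComplex.HomComplex

variable {k : Type u} [CommRing k] {𝒞 : Type v} [Category.{w} 𝒞] [Preadditive 𝒞] [Linear k 𝒞]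
  {ι : Type w'} {K : ι → CochainComplex 𝒞 ℤ} (c : Contraction k K) {X Y : ι}

lemma p_H {n m : ℤ} (h : m + 1 = n) (x : Cochain (K X) (K Y) n) :
    c.p X Y m (c.H X Y n m x) = 0 := by
  have hl : m - 1 + 1 = m := sub_add_cancel m 1
  have H_δ_H : c.H X Y n m (δ m n (c.H X Y n m x)) = c.H X Y n m x := by
    have hx := congrArg (c.H X Y n m) (c.homotopy X Y m n (n + 1) h rfl x)
    rw [map_sub, c.H_i X Y m n h, map_add, c.H_H X Y m n (n + 1) h rfl, sub_zero, add_zero] at hx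
    exact hx.symm
  have i_p_H : (c.i X Y m (c.p X Y m (c.H X Y n m x)) : Cochain (K X) (K Y) m) = 0 := by
    have hHx := c.homotopy X Y (m - 1) m n hl h (c.H X Y n m x)
    rwa [c.H_H X Y (m - 1) m n hl h, δ_zero, zero_add, H_δ_H, sub_eq_self] at hHx
  rw [← c.p_i X Y m (c.p X Y m (c.H X Y n m x)), i_p_H, map_zero]

lemma iTot_lof (n : ℤ) (x : HomCohomology k (K X) (K Y) n) :
    c.iTot X Y (lof k ℤ _ n x) = lof k ℤ (Cochain (K X) (K Y)) n (c.i X Y n x) := by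
  simp [iTot]

lemma pTot_lof (n : ℤ) (x : Cochain (K X) (K Y) n) :
    c.pTot X Y (lof k ℤ _ n x) = lof k ℤ (HomCohomology k (K X) (K Y)) n (c.p X Y n x) := by
  simp [pTot]

lemma hTot_lof {n m : ℤ} (h : m + 1 = n) (x : Cochain (K X) (K Y) n) :
    c.hTot X Y (lof k ℤ _ n x) =
      (n.negOnePow : ℤ) • lof k ℤ (Cochain (K X) (K Y)) m (c.H X Y n m x) := by
  obtain rfl : m = n - 1 := by omega
  simp [hTot]

lemma hTot_iTot (x : ⨁ n, HomCohomology k (K X) (K Y) n) : c.hTot X Y (c.iTot X Y x) = 0 := by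
  refine linearMap_congr_of_lof (F := c.hTot X Y ∘ₗ c.iTot X Y) (G := 0) (fun n x => ?_) x
  simp only [LinearMap.comp_apply, iTot_lof, hTot_lof _ (sub_add_cancel n 1),
    c.H_i X Y _ _ (sub_add_cancel n 1), map_zero, smul_zero, LinearMap.zero_apply]

lemma hTot_hTot (x : ⨁ n, Cochain (K X) (K Y) n) : c.hTot X Y (c.hTot X Y x) = 0 := by
  refine linearMap_congr_of_lof (F := c.hTot X Y ∘ₗ c.hTot X Y) (G := 0) (fun n x => ?_) x
  have hm := sub_add_cancel (n - 1) 1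
  have hn := sub_add_cancel n 1
  simp only [LinearMap.comp_apply, hTot_lof _ hn, hTot_lof _ hm, map_zsmul, c.H_H X Y _ _ _ hm hn,
    map_zero, smul_zero, LinearMap.zero_apply]

lemma pTot_hTot (x : ⨁ n, Cochain (K X) (K Y) n) : c.pTot X Y (c.hTot X Y x) = 0 := by
  refine linearMap_congr_of_lof (F := c.pTot X Y ∘ₗ c.hTot X Y) (G := 0) (fun n x => ?_) x
  simp only [LinearMap.comp_apply, hTot_lof _ (sub_add_cancel n 1), map_zsmul, pTot_lof,
    p_H _ (sub_add_cancel n 1), map_zero, smul_zero, LinearMap.zero_apply]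

lemma pTot_dTot (x : ⨁ n, Cochain (K X) (K Y) n) : c.pTot X Y (dTot k (K X) (K Y) x) = 0 := by
  refine linearMap_congr_of_lof (F := c.pTot X Y ∘ₗ dTot k (K X) (K Y)) (G := 0) (fun n x => ?_) x
  simp only [LinearMap.comp_apply, dTot_lof rfl, map_zsmul, pTot_lof, c.p_δ X Y n _ rfl, map_zero,
    smul_zero, LinearMap.zero_apply]

lemma pTot_iTot (x : ⨁ n, HomCohomology k (K X) (K Y) n) : c.pTot X Y (c.iTot X Y x) = x := by
  refine linearMap_congr_of_lof (F := c.pTot X Y ∘ₗ c.iTot X Y) (G := LinearMap.id)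
    (fun n x => ?_) x
  simp only [LinearMap.comp_apply, iTot_lof, pTot_lof, c.p_i X Y n, LinearMap.id_apply]

lemma dTot_iTot (x : ⨁ n, HomCohomology k (K X) (K Y) n) :
    dTot k (K X) (K Y) (c.iTot X Y x) = 0 := by
  refine linearMap_congr_of_lof (F := dTot k (K X) (K Y) ∘ₗ c.iTot X Y) (G := 0) (fun n x => ?_) x
  have hx : δ n (n + 1) (c.i X Y n x : Cochain (K X) (K Y) n) = 0 := (c.i X Y n x).2
  simp only [LinearMap.comp_apply, iTot_lof, dTot_lof rfl, hx, map_zero, smul_zero,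
    LinearMap.zero_apply]

lemma dTot_hTot (x : ⨁ n, Cochain (K X) (K Y) n) :
    dTot k (K X) (K Y) (c.hTot X Y x) =
      c.iTot X Y (c.pTot X Y x) - x - c.hTot X Y (dTot k (K X) (K Y) x) := by
  refine linearMap_congr_of_lof (F := dTot k (K X) (K Y) ∘ₗ c.hTot X Y)
    (G := c.iTot X Y ∘ₗ c.pTot X Y - LinearMap.id - c.hTot X Y ∘ₗ dTot k (K X) (K Y))
    (fun n x => ?_) x
  have hn := sub_add_cancel n 1
  have h : (c.i X Y n (c.p X Y n x) : Cochain (K X) (K Y) n) =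
      x - (δ (n - 1) n (c.H X Y n (n - 1) x) + c.H X Y (n + 1) n (δ n (n + 1) x)) :=
    (sub_eq_of_eq_add' (sub_eq_iff_eq_add.1 (c.homotopy X Y (n - 1) n (n + 1) hn rfl x))).symm
  simp only [LinearMap.comp_apply, LinearMap.sub_apply, LinearMap.id_apply, hTot_lof _ hn,
    hTot_lof (m := n) _ rfl, dTot_lof hn, dTot_lof (n := n) rfl, map_zsmul, pTot_lof, iTot_lof, h,
    map_sub, map_add, smul_smul, Int.negOnePow_sub, Int.negOnePow_succ, Int.negOnePow_one,
    Units.val_neg, mul_neg, mul_one, neg_smul, smul_neg, Int.units_coe_mul_self, one_smul]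
  abel

lemma iTot_signMap (x : ⨁ n, HomCohomology k (K X) (K Y) n) :
    c.iTot X Y (signMap k _ x) = signMap k _ (c.iTot X Y x) := by
  refine linearMap_congr_of_lof (F := c.iTot X Y ∘ₗ signMap k _)
    (G := signMap k _ ∘ₗ c.iTot X Y) (fun n x => ?_) x
  simp only [LinearMap.comp_apply, signMap_lof, map_zsmul, iTot_lof]

lemma pTot_signMap (x : ⨁ n, Cochain (K X) (K Y) n) :
    c.pTot X Y (signMap k _ x) = signMap k _ (c.pTot X Y x) := by
  refine linearMap_congr_of_lof (F := c.pTot X Y ∘ₗ signMap k _)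
    (G := signMap k _ ∘ₗ c.pTot X Y) (fun n x => ?_) x
  simp only [LinearMap.comp_apply, signMap_lof, map_zsmul, pTot_lof]

lemma hTot_signMap (x : ⨁ n, Cochain (K X) (K Y) n) :
    c.hTot X Y (signMap k _ x) = -signMap k _ (c.hTot X Y x) := by
  refine linearMap_congr_of_lof (F := c.hTot X Y ∘ₗ signMap k _)
    (G := -signMap k _ ∘ₗ c.hTot X Y) (fun n x => ?_) x
  simp only [LinearMap.comp_apply, LinearMap.neg_apply, signMap_lof, map_zsmul,
    hTot_lof _ (sub_add_cancel n 1), Int.negOnePow_sub, Int.negOnePow_one, mul_neg, mul_one,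
    Units.val_neg, neg_smul, smul_neg, neg_neg]

lemma iTot_mem_homogeneous {n : ℤ} {x : ⨁ n, HomCohomology k (K X) (K Y) n}
    (hx : x ∈ homogeneous k (HomCohomology k (K X) (K Y)) n) :
    c.iTot X Y x ∈ homogeneous k (Cochain (K X) (K Y)) n := by
  obtain ⟨x, rfl⟩ := hx
  rw [iTot_lof]
  exact lof_mem_homogeneous _ _

lemma pTot_mem_homogeneous {n : ℤ} {x : ⨁ n, Cochain (K X) (K Y) n}
    (hx : x ∈ homogeneous k (Cochain (K X) (K Y)) n) :
    c.pTot X Y x ∈ homogeneous k (HomCohomology k (K X) (K Y)) n := by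
  obtain ⟨x, rfl⟩ := hx
  rw [pTot_lof]
  exact lof_mem_homogeneous _ _

lemma hTot_mem_homogeneous {n : ℤ} {x : ⨁ n, Cochain (K X) (K Y) n}
    (hx : x ∈ homogeneous k (Cochain (K X) (K Y)) n) :
    c.hTot X Y x ∈ homogeneous k (Cochain (K X) (K Y)) (n - 1) := by
  obtain ⟨x, rfl⟩ := hx
  rw [hTot_lof _ (sub_add_cancel n 1)]
  exact zsmul_mem (lof_mem_homogeneous _ _) _

end Contraction

namespace CSeq

variable {Obj : Type v} {T : Obj → Obj → Type w} {X Y : Obj}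

/-- The trees spelling `p` that have a branch point at the root, given the trees `t` available for
the two pieces of a cut of `p`. -/
def nodes (t : ∀ {X Y : Obj}, CSeq T X Y → List (BTree T X Y)) (p : CSeq T X Y) :
    List (BTree T X Y) :=
  p.cuts.flatMap fun c => (t c.2.1).flatMap fun l => (t c.2.2).map fun r => BTree.node l r

lemma treesAux_nil (n : ℕ) : treesAux n (nil X : CSeq T X X) = [] := by
  induction n with
  | zero => rfl
  | succ n ih => simp [treesAux, leafTree, cuts, ih]

lemma nodes_congr {t t' : ∀ {X Y : Obj}, CSeq T X Y → List (BTree T X Y)} (p : CSeq T X Y)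
    (h_nil : ∀ X : Obj, t (nil X) = []) (h_nil' : ∀ X : Obj, t' (nil X) = [])
    (h : ∀ {X Y : Obj} (q : CSeq T X Y), q.length < p.length → t q = t' q) :
    nodes t p = nodes t' p := by
  refine List.flatMap_congr fun ⟨Z, a, b⟩ hc => ?_
  have hab : a.append b = p := append_of_mem_cuts p _ hc
  have h_length : a.length + b.length = p.length := by rw [← hab, length_append]
  cases a with
  | nil => simp [h_nil, h_nil']
  | cons f a =>
    cases b with
    | nil =>
      have h_empty (ls : List (BTree T X Y)) :
          (ls.flatMap fun _ => ([] : List (BTree T X Y))) = [] :=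
        List.flatMap_eq_nil_iff.2 fun _ _ => rfl
      simp only [h_nil, h_nil', List.map_nil, h_empty]
    | cons g b =>
      simp only [length] at h_length
      simp only [h (cons f a) (by simp only [length]; omega),
        h (cons g b) (by simp only [length]; omega)]

lemma treesAux_succ_of_length_le (n : ℕ) (p : CSeq T X Y) (hp : p.length ≤ n) :
    treesAux (n + 1) p = treesAux n p := by
  induction n generalizing X Y with
  | zero =>
    cases p with
    | nil => exact treesAux_nil 1
    | cons f p => simp [length] at hp
  | succ n ih =>
    exact congrArg (p.leafTree ++ ·) (nodes_congr p (fun _ => treesAux_nil _)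
      (fun _ => treesAux_nil _) fun q hq => ih q (by omega))

lemma treesAux_of_length_le {n : ℕ} (p : CSeq T X Y) (hp : p.length ≤ n) :
    treesAux n p = p.trees := by
  induction n, hp using Nat.le_induction with
  | base => rfl
  | succ n hn ih => rw [treesAux_succ_of_length_le n p hn, ih]

lemma trees_eq (p : CSeq T X Y) : p.trees = p.leafTree ++ nodes trees p := by
  rw [← treesAux_of_length_le p (Nat.le_succ p.length)]
  exact congrArg (p.leafTree ++ ·) (nodes_congr p (fun _ => treesAux_nil _) (fun _ => rfl)
    fun q hq => treesAux_of_length_le q hq.le)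

lemma isLinearMap_cutSum {k V A : Type*} [Semiring k] [AddCommMonoid V] [Module k V]
    [AddCommMonoid A] [Module k A] (ψ : V → ∀ Z, CSeq T X Z → CSeq T Z Y → A) (p : CSeq T X Y)
    (h : ∀ Z a b, a.append b = p → IsLinearMap k fun v => ψ v Z a b) :
    IsLinearMap k fun v => cutSum (ψ v) p where
  map_add v v' := by
    rw [← cutSum_add]
    exact cutSum_congr p fun Z a b hab => (h Z a b hab).map_add v v'
  map_smul r v := by
    refine (cutSum_congr p fun Z a b hab => (h Z a b hab).map_smul r v).trans ?_
    exact (map_cutSum (DistribSMul.toAddMonoidHom A r) (ψ v) p).symm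

end CSeq

namespace AInfData

variable {k : Type u} [CommRing k] {C : AInfData.{u, v, w} k} {X Y Z : C.Obj}

lemma HomogSeq.of_append {p : CSeq C.Tot X Y} {q : CSeq C.Tot Y Z} {s : ℤ}
    (h : C.HomogSeq (p.append q) s) :
    ∃ a b, C.HomogSeq p a ∧ C.HomogSeq q b ∧ a + b = s := by
  induction p generalizing s with
  | nil X => exact ⟨0, s, .nil X, h, zero_add s⟩
  | cons f p ih =>
    obtain _ | ⟨hf, hp⟩ := h
    obtain ⟨a, b, ha, hb, rfl⟩ := ih hp
    exact ⟨_, b, .cons hf ha, hb, add_assoc _ a b⟩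

lemma insertSum_eq_ins {U : C.Obj → C.Obj → Type w'} [∀ X Y, AddCommGroup (U X Y)]
    (φ : ∀ {X Y : C.Obj}, CSeq C.Tot X Y → U X Y) (p : CSeq C.Tot X Y) :
    C.insertSum φ p =
      CSeq.ins C.m (fun {X Y} f => -signMap k (C.Hom X Y) f) (fun q => φ q) p :=
  rfl

end AInfData

namespace Contraction

open CSeq CochainComplex.HomComplex

variable {k : Type u} [CommRing k] {𝒞 : Type v} [Category.{w} 𝒞] [Preadditive 𝒞] [Linear k 𝒞]
  {ι : Type w'} {K : ι → CochainComplex 𝒞 ℤ} (c : Contraction k K) {W X Y Z : ι}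

variable (k K) in
/-- Composable sequences of cohomology classes. -/
abbrev CohSeq := CSeq (fun X Y => ⨁ n, HomCohomology k (K X) (K Y) n)

/-- The sum of the values of the trees without branch points spelling a sequence. -/
def leafSum : CohSeq k K X Y → ⨁ n, Cochain (K X) (K Y) n
  | nil _ => 0
  | cons f (nil _) => c.iTot _ _ f
  | cons _ (cons _ _) => 0

/-- The sum of the values `Contraction.edgeValue` of all trees spelling a sequence. These are the
components of an `A_∞`-functor from the transferred structure to the dg category. -/
def edgeSum (p : CohSeq k K X Y) : ⨁ n, Cochain (K X) (K Y) n :=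
  (p.trees.map c.edgeValue).sum

/-- The sum over all trees spelling a sequence and having a branch point at the root, of the value
of the tree before `H` or `p` is applied at the root. -/
def branchSum (p : CohSeq k K X Z) : ⨁ n, Cochain (K X) (K Z) n :=
  cutSum (fun Y a b => signedComp k (K X) (K Y) (K Z) (c.edgeSum b) (c.edgeSum a)) p

/-- The operations of the transferred structure, see `Contraction.transfer_m`. -/
def rootSum (p : CohSeq k K X Y) : ⨁ n, HomCohomology k (K X) (K Y) n :=
  c.pTot X Y (c.branchSum p)

lemma leafSum_of_two_le (p : CohSeq k K X Y) (hp : 2 ≤ p.length) : c.leafSum p = 0 := by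
  match p, hp with
  | cons _ (cons _ _), _ => rfl

lemma sum_map_nodes {A : Type*} [AddCommGroup A] [Module k A]
    (g : (⨁ n, Cochain (K X) (K Z) n) →ₗ[k] A)
    (v : BTree (fun X Y => ⨁ n, HomCohomology k (K X) (K Y) n) X Z → A)
    (hv : ∀ Y (l : BTree _ X Y) (r : BTree _ Y Z), v (.node l r) =
      g (signedComp k (K X) (K Y) (K Z) (c.edgeValue r) (c.edgeValue l)))
    (p : CohSeq k K X Z) : ((nodes trees p).map v).sum = g (c.branchSum p) := by
  have h_bilinear (Y : ι) (ls : List (BTree _ X Y)) (rs : List (BTree _ Y Z)) :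
      ((ls.flatMap fun l => rs.map fun r => BTree.node l r).map v).sum =
        g (signedComp k (K X) (K Y) (K Z) (rs.map c.edgeValue).sum (ls.map c.edgeValue).sum) := by
    induction ls with
    | nil => simp
    | cons l ls ih =>
      have h_left : ((rs.map fun r => BTree.node l r).map v).sum =
          g (signedComp k (K X) (K Y) (K Z) (rs.map c.edgeValue).sum (c.edgeValue l)) := by
        clear ih
        induction rs with
        | nil => simp
        | cons r rs ih => simpa [hv] using ih
      simp only [List.flatMap_cons, List.map_append, List.sum_append, h_left, ih, List.map_cons,
        List.sum_cons, map_add]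
  rw [branchSum, map_cutSum, cutSum, nodes, List.flatMap_def, List.map_flatten, List.sum_flatten,
    List.map_map, List.map_map]
  exact congrArg List.sum (List.map_congr_left fun q _ => h_bilinear q.1 _ _)

lemma edgeSum_eq (p : CohSeq k K X Y) :
    c.edgeSum p = c.leafSum p + c.hTot X Y (c.branchSum p) := by
  have h_leaf : (p.leafTree.map c.edgeValue).sum = c.leafSum p := by
    match p with
    | nil _ => rfl
    | cons f (nil _) => exact add_zero _
    | cons _ (cons _ _) => rfl
  rw [edgeSum, trees_eq, List.map_append, List.sum_append, h_leaf,
    c.sum_map_nodes (c.hTot X Y) c.edgeValue fun _ _ _ => rfl]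

lemma transfer_m (p : CohSeq k K X Y) : c.transfer.m p = c.rootSum p := by
  have h_leaf : (p.leafTree.map c.rootValue).sum = 0 := by
    match p with
    | nil _ => rfl
    | cons f (nil _) => exact add_zero _
    | cons _ (cons _ _) => rfl
  change (p.trees.map c.rootValue).sum = _
  rw [rootSum, trees_eq, List.map_append, List.sum_append, h_leaf, zero_add,
    c.sum_map_nodes (c.pTot X Y) c.rootValue fun _ _ _ => rfl]

@[simp] lemma edgeSum_nil (X : ι) : c.edgeSum (nil X) = 0 := rfl

@[simp] lemma branchSum_single (f : ⨁ n, HomCohomology k (K X) (K Y) n) :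
    c.branchSum (single f) = 0 := by
  simp [branchSum, single, cutSum_cons]

@[simp] lemma edgeSum_single (f : ⨁ n, HomCohomology k (K X) (K Y) n) :
    c.edgeSum (single f) = c.iTot X Y f := by
  rw [edgeSum_eq, branchSum_single, map_zero, add_zero]
  rfl

lemma branchSum_pair (g : ⨁ n, HomCohomology k (K Y) (K Z) n)
    (f : ⨁ n, HomCohomology k (K X) (K Y) n) : c.branchSum (pair g f) =
      signedComp k (K X) (K Y) (K Z) (c.iTot Y Z g) (c.iTot X Y f) := by
  rw [branchSum, pair, single, cutSum_cons, cutSum_cons, cutSum_nil, edgeSum_nil, edgeSum_nil,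
    map_zero, map_zero, LinearMap.zero_apply, zero_add, add_zero]
  exact congrArg₂ (fun x y => signedComp k (K X) (K Y) (K Z) x y) (c.edgeSum_single g)
    (c.edgeSum_single f)

/-! ### Multilinearity and degrees of the transferred operations -/

lemma isLinearMap_leafSum (p : CohSeq k K W X) (q : CohSeq k K Y Z) :
    IsLinearMap k fun f => c.leafSum (p.append (cons f q)) := by
  cases p with
  | nil =>
    cases q with
    | nil => exact (c.iTot W Y).isLinear
    | cons g q => exact (0 : _ →ₗ[k] _).isLinear
  | cons e p =>
    have h_zero (f) : c.leafSum ((cons e p).append (cons f q)) = 0 :=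
      c.leafSum_of_two_le _ (by simp only [length_append, length]; omega)
    simp only [h_zero]
    exact (0 : _ →ₗ[k] _).isLinear

lemma isLinearMap_branchSum_of_lt (p : CohSeq k K W X) (q : CohSeq k K Y Z)
    (hp : ∀ V (b : CohSeq k K V X), b.length < p.length →
      IsLinearMap k fun f => c.edgeSum (b.append (cons f q)))
    (hq : ∀ V (a : CohSeq k K Y V), a.length < q.length →
      IsLinearMap k fun f => c.edgeSum (p.append (cons f a))) :
    IsLinearMap k fun f => c.branchSum (p.append (cons f q)) := by
  have h_left : IsLinearMap k fun f => cutSum (fun V a b => signedComp k (K W) (K V) (K Z)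
      (c.edgeSum (b.append (cons f q))) (c.edgeSum a)) p := by
    refine isLinearMap_cutSum _ p fun V a b hab => ?_
    cases a with
    | nil =>
      simp only [edgeSum_nil, map_zero]
      exact (0 : _ →ₗ[k] _).isLinear
    | cons e a =>
      exact ((signedComp k (K W) (K V) (K Z)).flip (c.edgeSum (cons e a)) ∘ₗ
        (hp V b (by simp [← hab, length])).mk' _).isLinear
  have h_right : IsLinearMap k fun f => cutSum (fun V a b => signedComp k (K W) (K V) (K Z)
      (c.edgeSum b) (c.edgeSum (p.append (cons f a)))) q := by
    refine isLinearMap_cutSum _ q fun V a b hab => ?_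
    cases b with
    | nil =>
      simp only [edgeSum_nil, map_zero, LinearMap.zero_apply]
      exact (0 : _ →ₗ[k] _).isLinear
    | cons e b =>
      exact (signedComp k (K W) (K V) (K Z) (c.edgeSum (cons e b)) ∘ₗ
        (hq V a (by simp [← hab, length])).mk' _).isLinear
  simp only [branchSum, cutSum_append_cons]
  exact (h_left.mk' _ + h_right.mk' _).isLinear

lemma isLinearMap_edgeSum (p : CohSeq k K W X) (q : CohSeq k K Y Z) :
    IsLinearMap k fun f => c.edgeSum (p.append (cons f q)) := by
  induction hn : p.length + q.length using Nat.strong_induction_on generalizing W X Y Z with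
  | _ n ih =>
    have h_branch := c.isLinearMap_branchSum_of_lt p q
      (fun _ b hb => ih _ (by omega) b q rfl) (fun _ a ha => ih _ (by omega) p a rfl)
    simp only [edgeSum_eq]
    exact ((c.isLinearMap_leafSum p q).mk' _ + c.hTot W Z ∘ₗ h_branch.mk' _).isLinear

lemma isLinearMap_branchSum (p : CohSeq k K W X) (q : CohSeq k K Y Z) :
    IsLinearMap k fun f => c.branchSum (p.append (cons f q)) :=
  c.isLinearMap_branchSum_of_lt p q (fun _ b _ => c.isLinearMap_edgeSum b q)
    (fun _ a _ => c.isLinearMap_edgeSum p a)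

lemma leafSum_mem_homogeneous (p : CohSeq k K X Y) {s : ℤ} (hp : c.transfer.HomogSeq p s) :
    c.leafSum p ∈ homogeneous k (Cochain (K X) (K Y)) (s + 1 - p.length) := by
  match p, hp with
  | nil _, _ => exact zero_mem _
  | cons _ (nil _), .cons (a := a) hf (.nil _) =>
    have hs : a + 0 + 1 - ((0 + 1 : ℕ) : ℤ) = a := by omega
    change c.iTot _ _ _ ∈ homogeneous k _ (a + 0 + 1 - ((0 + 1 : ℕ) : ℤ))
    rw [hs]
    exact c.iTot_mem_homogeneous hf
  | cons _ (cons _ _), _ => exact zero_mem _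

lemma branchSum_mem_homogeneous_of_lt (p : CohSeq k K X Z) {s : ℤ}
    (hp : c.transfer.HomogSeq p s)
    (ih : ∀ {Y Y'} (q : CohSeq k K Y Y') {t : ℤ}, q.length < p.length →
      c.transfer.HomogSeq q t →
        c.edgeSum q ∈ homogeneous k (Cochain (K Y) (K Y')) (t + 1 - q.length)) :
    c.branchSum p ∈ homogeneous k (Cochain (K X) (K Z)) (s + 2 - p.length) := by
  refine cutSum_mem _ _ p fun Y a b hab => ?_
  subst hab
  obtain ⟨t, t', ha, hb, rfl⟩ := hp.of_append
  cases a with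
  | nil => simp
  | cons f a =>
    cases b with
    | nil => simp
    | cons g b =>
      have h := signedComp_mem_homogeneous (ih (cons g b) (by simp [length]) hb)
        (ih (cons f a) (by simp [length]) ha)
      convert h using 2
      rw [length_append]
      push_cast
      ring

lemma edgeSum_mem_homogeneous (p : CohSeq k K X Y) {s : ℤ} (hp : c.transfer.HomogSeq p s) :
    c.edgeSum p ∈ homogeneous k (Cochain (K X) (K Y)) (s + 1 - p.length) := by
  induction hn : p.length using Nat.strong_induction_on generalizing X Y s with
  | _ n ih =>
    have h_branch := c.hTot_mem_homogeneous (c.branchSum_mem_homogeneous_of_lt p hp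
      fun q _ hq h => ih _ (hn ▸ hq) q h rfl)
    rw [edgeSum_eq, ← hn]
    refine add_mem (c.leafSum_mem_homogeneous p hp) ?_
    convert h_branch using 2
    ring

lemma branchSum_mem_homogeneous (p : CohSeq k K X Y) {s : ℤ} (hp : c.transfer.HomogSeq p s) :
    c.branchSum p ∈ homogeneous k (Cochain (K X) (K Y)) (s + 2 - p.length) :=
  c.branchSum_mem_homogeneous_of_lt p hp fun q _ _ h => c.edgeSum_mem_homogeneous q h

lemma isLinearMap_rootSum (p : CohSeq k K W X) (q : CohSeq k K Y Z) :
    IsLinearMap k fun f => c.rootSum (p.append (cons f q)) := by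
  simp only [rootSum]
  exact (c.pTot W Z ∘ₗ (c.isLinearMap_branchSum p q).mk' _).isLinear

lemma rootSum_mem_homogeneous (p : CohSeq k K X Y) {s : ℤ} (hp : c.transfer.HomogSeq p s) :
    c.rootSum p ∈ homogeneous k (HomCohomology k (K X) (K Y)) (s + 2 - p.length) := by
  rw [rootSum]
  exact c.pTot_mem_homogeneous (c.branchSum_mem_homogeneous p hp)

end Contraction

namespace Contraction

open CSeq CochainComplex.HomComplex

variable {k : Type u} [CommRing k] {𝒞 : Type v} [Category.{w} 𝒞] [Preadditive 𝒞] [Linear k 𝒞]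
  {ι : Type w'} {K : ι → CochainComplex 𝒞 ℤ} (c : Contraction k K) {W X Y Z : ι}

/-- The sign `(-1) ^ (|f| - 1)` by which `AInfData.twist` multiplies an entry `f`, for the
transferred structure. -/
def cohSign (f : ⨁ n, HomCohomology k (K X) (K Y) n) : ⨁ n, HomCohomology k (K X) (K Y) n :=
  -signMap k (HomCohomology k (K X) (K Y)) f

/-- `AInfData.insertSum` for the transferred structure, for functions on the sequences with fixed
endpoints. -/
abbrev insSum {A : Type*} [AddCommMonoid A] (φ : CohSeq k K X Y → A) (p : CohSeq k K X Y) : A :=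
  ins c.rootSum cohSign φ p

lemma leafSum_map_cohSign (p : CohSeq k K X Y) :
    c.leafSum (X := X) (Y := Y) (p.map id cohSign) =
      -signMap k (Cochain (K X) (K Y)) (c.leafSum p) := by
  match p with
  | nil _ => exact (by simp : (0 : ⨁ n, Cochain (K _) (K _) n) = -signMap k _ 0)
  | cons f (nil _) => exact (map_neg _ _).trans (congrArg Neg.neg (c.iTot_signMap f))
  | cons _ (cons _ _) => exact (by simp : (0 : ⨁ n, Cochain (K _) (K _) n) = -signMap k _ 0)

lemma edgeSum_map_cohSign (p : CohSeq k K X Y) :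
    c.edgeSum (X := X) (Y := Y) (p.map id cohSign) =
      -signMap k (Cochain (K X) (K Y)) (c.edgeSum p) := by
  induction hn : p.length using Nat.strong_induction_on generalizing X Y with
  | _ n ih =>
    have h_branch : c.branchSum (X := X) (Z := Y) (p.map id cohSign) =
        signMap k (Cochain (K X) (K Y)) (c.branchSum p) := by
      rw [branchSum.eq_def c p, map_cutSum]
      refine (cutSum_map (T' := fun X Y => ⨁ n, HomCohomology k (K X) (K Y) n) id cohSign _ p).trans
        (cutSum_congr_of_lt p ?_ ?_ fun V a b ha hb => ?_)
      · simp [CSeq.map]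
      · simp [CSeq.map]
      · dsimp only [id]
        rw [signMap_signedComp, ih _ (hn ▸ ha) a rfl, ih _ (hn ▸ hb) b rfl]
        simp only [map_neg, LinearMap.neg_apply, neg_neg]
    rw [edgeSum_eq, edgeSum_eq, leafSum_map_cohSign, h_branch, hTot_signMap, map_add, neg_add]

/-! ### The `A_∞`-relations of the transferred operations -/

/-- Measures the failure of the `edgeSum`s to satisfy the relations of an `A_∞`-functor to the dg
category. -/
def edgeDefect (p : CohSeq k K X Y) : ⨁ n, Cochain (K X) (K Y) n :=
  dTot k (K X) (K Y) (c.edgeSum p) + c.branchSum p - c.insSum c.edgeSum p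

/-- Measures the failure of the `branchSum`s to commute with the differentials, the differential of
a sequence being the sum over the insertions of transferred operations. -/
def branchDefect (p : CohSeq k K X Y) : ⨁ n, Cochain (K X) (K Y) n :=
  dTot k (K X) (K Y) (c.branchSum p) + c.insSum c.branchSum p

lemma dTot_leafSum (p : CohSeq k K X Y) : dTot k (K X) (K Y) (c.leafSum p) = 0 := by
  match p with
  | nil _ => exact map_zero _
  | cons f (nil _) => exact c.dTot_iTot f
  | cons _ (cons _ _) => exact map_zero _

lemma insSum_leafSum (p : CohSeq k K X Y) :
    c.insSum c.leafSum p = c.iTot X Y (c.pTot X Y (c.branchSum p)) := by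
  cases p with
  | nil X => simp [insSum, branchSum]
  | cons f p =>
    rw [insSum, ins_eq_single _ _ _ c.leafSum_of_two_le _ (by simp [length]), rootSum]
    rfl

lemma insSum_branchSum (p : CohSeq k K X Z) :
    c.insSum c.branchSum p = cutSum (fun Y l r =>
      signedComp k (K X) (K Y) (K Z) (c.edgeSum r) (c.insSum c.edgeSum l) -
        signedComp k (K X) (K Y) (K Z) (c.insSum c.edgeSum r) (signMap k _ (c.edgeSum l))) p := by
  refine (ins_cutSum _ _ _ p).trans (cutSum_congr p fun Y l r _ => ?_)
  have h_right : c.insSum (fun b => signedComp k (K X) (K Y) (K Z) (c.edgeSum b)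
      (c.edgeSum (X := X) (Y := Y) (l.map id cohSign))) r =
      -signedComp k (K X) (K Y) (K Z) (c.insSum c.edgeSum r) (signMap k _ (c.edgeSum l)) := by
    simpa [edgeSum_map_cohSign] using (map_ins c.rootSum cohSign
      (-(signedComp k (K X) (K Y) (K Z)).flip (signMap k _ (c.edgeSum l))) c.edgeSum r).symm
  rw [sub_eq_add_neg, ← h_right, insSum, map_ins]

lemma cutSum_signedComp_branchSum (p : CohSeq k K X Z) :
    cutSum (fun Y l r => signedComp k (K X) (K Y) (K Z) (c.edgeSum r) (c.branchSum l)) p =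
      cutSum (fun Y l r =>
        signedComp k (K X) (K Y) (K Z) (c.branchSum r) (signMap k _ (c.edgeSum l))) p := by
  have h_right (Y : ι) (l : CohSeq k K X Y) (r : CohSeq k K Y Z) :
      signedComp k (K X) (K Y) (K Z) (c.branchSum r) (signMap k _ (c.edgeSum l)) =
        cutSum (fun V a b => signedComp k (K X) (K Y) (K Z) (signedComp k (K Y) (K V) (K Z)
          (c.edgeSum b) (c.edgeSum a)) (signMap k _ (c.edgeSum l))) r := by
    rw [← LinearMap.flip_apply (signedComp k _ _ _), branchSum, map_cutSum]
    rfl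
  simp only [h_right, cutSum_cutSum]
  refine cutSum_congr p fun Y l r _ => ?_
  rw [branchSum, map_cutSum]
  exact cutSum_congr l fun V a b _ => signedComp_assoc _ _ _

lemma edgeDefect_eq_neg_hTot_branchDefect (p : CohSeq k K X Y) :
    c.edgeDefect p = -c.hTot X Y (c.branchDefect p) := by
  have h_ins : c.insSum c.edgeSum p =
      c.iTot X Y (c.pTot X Y (c.branchSum p)) + c.hTot X Y (c.insSum c.branchSum p) := by
    rw [← insSum_leafSum, insSum, insSum, insSum, map_ins, ← ins_add]
    exact congrArg (fun φ => ins c.rootSum cohSign φ p) (funext c.edgeSum_eq)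
  rw [edgeDefect, branchDefect, h_ins, edgeSum_eq, map_add, dTot_leafSum, dTot_hTot, map_add]
  abel

lemma branchDefect_eq_cutSum_edgeDefect (p : CohSeq k K X Z) :
    c.branchDefect p = cutSum (fun Y l r =>
      signedComp k (K X) (K Y) (K Z) (c.edgeDefect r) (signMap k _ (c.edgeSum l)) -
        signedComp k (K X) (K Y) (K Z) (c.edgeSum r) (c.edgeDefect l)) p := by
  have h_d : dTot k (K X) (K Z) (c.branchSum p) = cutSum (fun Y l r =>
      signedComp k (K X) (K Y) (K Z) (dTot k _ _ (c.edgeSum r)) (signMap k _ (c.edgeSum l)) -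
        signedComp k (K X) (K Y) (K Z) (c.edgeSum r) (dTot k _ _ (c.edgeSum l))) p := by
    rw [branchSum, map_cutSum]
    exact cutSum_congr p fun Y l r _ => dTot_signedComp _ _
  rw [branchDefect, h_d, insSum_branchSum]
  simp only [edgeDefect, map_sub, map_add, LinearMap.sub_apply, LinearMap.add_apply, cutSum_sub,
    cutSum_add, cutSum_signedComp_branchSum]
  abel

lemma edgeDefect_eq_zero (p : CohSeq k K X Y) : c.edgeDefect p = 0 := by
  induction hn : p.length using Nat.strong_induction_on generalizing X Y with
  | _ n ih =>
    have h_nil (V : ι) : c.edgeDefect (nil V) = 0 := by simp [edgeDefect, insSum, branchSum]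
    have h_branch : c.branchDefect p = 0 := by
      rw [branchDefect_eq_cutSum_edgeDefect, ← cutSum_zero p]
      refine cutSum_congr_of_lt p ?_ ?_ fun V a b ha hb => ?_
      · simp [h_nil]
      · simp [h_nil]
      · simp [ih _ (hn ▸ ha) a rfl, ih _ (hn ▸ hb) b rfl]
    rw [edgeDefect_eq_neg_hTot_branchDefect, h_branch, map_zero, neg_zero]

lemma branchDefect_eq_zero (p : CohSeq k K X Y) : c.branchDefect p = 0 := by
  simp [branchDefect_eq_cutSum_edgeDefect, edgeDefect_eq_zero]

lemma insSum_rootSum (p : CohSeq k K X Y) : c.insSum c.rootSum p = 0 := by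
  have h_branch : c.insSum c.branchSum p = -dTot k (K X) (K Y) (c.branchSum p) :=
    eq_neg_of_add_eq_zero_right (c.branchDefect_eq_zero p)
  calc c.insSum c.rootSum p = c.pTot X Y (c.insSum c.branchSum p) :=
        (map_ins _ _ (c.pTot X Y) _ _).symm
    _ = 0 := by rw [h_branch, map_neg, pTot_dTot, neg_zero]

/-! ### Strict units -/

variable (k K) in
/-- The class of the identity. -/
def cohUnit (X : ι) : ⨁ n, HomCohomology k (K X) (K X) n :=
  lof k ℤ (HomCohomology k (K X) (K X)) 0 (cohClass k (Cochain.ofHom (𝟙 (K X))) (by simp))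

/-- The identity cochains are the chosen representatives of their cohomology classes. -/
def IsUnital : Prop :=
  ∀ X, c.i X X 0 (cohClass k (Cochain.ofHom (𝟙 (K X))) (by simp)) = Cochain.ofHom (𝟙 (K X))

lemma hTot_leafSum (p : CohSeq k K X Y) : c.hTot X Y (c.leafSum p) = 0 := by
  match p with
  | nil _ => exact map_zero _
  | cons f (nil _) => exact c.hTot_iTot f
  | cons _ (cons _ _) => exact map_zero _

lemma hTot_edgeSum (p : CohSeq k K X Y) : c.hTot X Y (c.edgeSum p) = 0 := by
  rw [edgeSum_eq, map_add, hTot_leafSum, hTot_hTot, add_zero]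

lemma pTot_edgeSum (p : CohSeq k K X Y) (hp : p.length ≠ 1) :
    c.pTot X Y (c.edgeSum p) = 0 := by
  have h_leaf : c.leafSum p = 0 := by
    match p with
    | nil _ => rfl
    | cons f (nil _) => simp [length] at hp
    | cons _ (cons _ _) => rfl
  rw [edgeSum_eq, h_leaf, zero_add, pTot_hTot]

namespace IsUnital

variable {c} (hc : c.IsUnital)
include hc

lemma iTot_cohUnit (X : ι) : c.iTot X X (cohUnit k K X) =
    lof k ℤ (Cochain (K X) (K X)) 0 (Cochain.ofHom (𝟙 (K X))) := by
  rw [cohUnit, iTot_lof, hc X]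

lemma branchSum_cons_cohUnit (q : CohSeq k K X Y)
    (h : ∀ V (a : CohSeq k K X V), a.length < q.length → 1 ≤ a.length →
      c.edgeSum (cons (cohUnit k K X) a) = 0) :
    c.branchSum (cons (cohUnit k K X) q) = c.edgeSum q := by
  rw [branchSum, cutSum_cons, edgeSum_nil, map_zero, zero_add, cutSum_eq_nil_left]
  · rw [← single, edgeSum_single, hc.iTot_cohUnit, signedComp_id]
  · intro V a b hab ha
    cases b with
    | nil => rw [edgeSum_nil, map_zero, LinearMap.zero_apply]
    | cons g b => rw [h V a (by simp [← hab, length]) ha, map_zero]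

lemma branchSum_append_cohUnit (p : CohSeq k K X Y)
    (h : ∀ V (b : CohSeq k K V Y), b.length < p.length → 1 ≤ b.length →
      c.edgeSum (b.append (single (cohUnit k K Y))) = 0) :
    c.branchSum (p.append (single (cohUnit k K Y))) = signMap k _ (c.edgeSum p) := by
  rw [branchSum, single, cutSum_append_cons, cutSum_nil, edgeSum_nil, map_zero,
    LinearMap.zero_apply, add_zero, cutSum_eq_nil_right]
  · rw [append, ← single, edgeSum_single, hc.iTot_cohUnit, id_signedComp]
  · intro V a b hab hb
    cases a with
    | nil => rw [edgeSum_nil, map_zero]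
    | cons g a =>
      rw [← single, h V b (by simp [← hab, length]) hb, map_zero, LinearMap.zero_apply]

omit hc in
lemma branchSum_cohUnit (p : CohSeq k K W X) (q : CohSeq k K X Y)
    (hp : ∀ V (b : CohSeq k K V X), b.length < p.length →
      c.edgeSum (b.append (cons (cohUnit k K X) q)) = 0)
    (hq : ∀ V (a : CohSeq k K X V), a.length < q.length →
      c.edgeSum (p.append (cons (cohUnit k K X) a)) = 0) :
    c.branchSum (p.append (cons (cohUnit k K X) q)) = 0 := by
  rw [branchSum, cutSum_append_cons, cutSum_eq_zero _ p, cutSum_eq_zero _ q, add_zero]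
  · intro V a b hab
    cases b with
    | nil => rw [edgeSum_nil, map_zero, LinearMap.zero_apply]
    | cons e b => rw [hq V a (by simp [← hab, length]), map_zero]
  · intro V a b hab
    cases a with
    | nil => rw [edgeSum_nil, map_zero]
    | cons e a => rw [hp V b (by simp [← hab, length]), map_zero, LinearMap.zero_apply]

lemma edgeSum_cohUnit (p : CohSeq k K W X) (q : CohSeq k K X Y) (hpq : 1 ≤ p.length + q.length) :
    c.edgeSum (p.append (cons (cohUnit k K X) q)) = 0 := by
  induction hn : p.length + q.length using Nat.strong_induction_on generalizing W X Y with
  | _ n ih =>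
    rw [edgeSum_eq, c.leafSum_of_two_le _ (by simp only [length_append, length]; omega), zero_add]
    cases p with
    | nil =>
      rw [append, hc.branchSum_cons_cohUnit q fun V a ha ha' =>
        ih _ (by simp only [length] at *; omega) (nil _) a (by omega) rfl, hTot_edgeSum]
    | cons f p =>
      cases q with
      | nil =>
        rw [← single, hc.branchSum_append_cohUnit _ fun V b hb hb' =>
          ih _ (by simp only [length] at *; omega) b (nil _) (by omega) rfl,
          hTot_signMap, hTot_edgeSum, map_zero, neg_zero]
      | cons g q =>
        rw [branchSum_cohUnit, map_zero]
        · exact fun V b hb => ih _ (by omega) b (cons g q) (by simp only [length]; omega) rfl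
        · exact fun V a ha => ih _ (by omega) (cons f p) a (by simp only [length]; omega) rfl

lemma rootSum_cohUnit (p : CohSeq k K W X) (q : CohSeq k K X Y) (hpq : p.length + q.length ≠ 1) :
    c.rootSum (p.append (cons (cohUnit k K X) q)) = 0 := by
  rw [rootSum]
  cases p with
  | nil =>
    rw [append, hc.branchSum_cons_cohUnit q fun V a _ ha =>
      hc.edgeSum_cohUnit (nil _) a (by omega), pTot_edgeSum]
    simpa [length] using hpq
  | cons f p =>
    cases q with
    | nil =>
      rw [← single, hc.branchSum_append_cohUnit _ fun V b _ hb =>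
        hc.edgeSum_cohUnit b (nil _) (by omega), pTot_signMap, pTot_edgeSum _ _ hpq, map_zero]
    | cons g q =>
      rw [branchSum_cohUnit, map_zero]
      · exact fun V b _ => hc.edgeSum_cohUnit b (cons g q) (by simp only [length]; omega)
      · exact fun V a _ => hc.edgeSum_cohUnit (cons f p) a (by simp only [length]; omega)

lemma rootSum_pair_cohUnit (f : ⨁ n, HomCohomology k (K X) (K Y) n) :
    c.rootSum (pair f (cohUnit k K X)) = f := by
  rw [rootSum, branchSum_pair, hc.iTot_cohUnit, signedComp_id, pTot_iTot]

lemma signMap_rootSum_cohUnit_pair (g : ⨁ n, HomCohomology k (K X) (K Y) n) :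
    signMap k (HomCohomology k (K X) (K Y)) (c.rootSum (pair (cohUnit k K Y) g)) = g := by
  rw [rootSum, branchSum_pair, hc.iTot_cohUnit, id_signedComp, pTot_signMap, pTot_iTot,
    signMap_signMap]

theorem isAInfCategory : c.transfer.IsAInfCategory := by
  have h_m : @AInfData.m _ _ c.transfer = @rootSum _ _ _ _ _ _ _ _ c := by
    funext X Y p
    exact c.transfer_m p
  refine ⟨fun X => rfl, ⟨?_, ?_⟩, ?_, ?_, ?_, ?_, ?_⟩
  · intro W X Y Z
    rw [h_m]
    exact fun p f g q => (c.isLinearMap_rootSum p q).map_add f g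
  · intro W X Y Z
    rw [h_m]
    exact fun p a f q => (c.isLinearMap_rootSum p q).map_smul a f
  · intro X Y p s hp
    rw [h_m]
    exact c.rootSum_mem_homogeneous p hp
  · intro X Y p
    rw [AInfData.insertSum_eq_ins, h_m]
    exact c.insSum_rootSum p
  · intro X Y f
    rw [h_m]
    exact hc.rootSum_pair_cohUnit f
  · intro X Y g
    rw [h_m]
    exact hc.signMap_rootSum_cohUnit_pair g
  · intro W X Y p q hpq
    rw [h_m]
    exact hc.rootSum_cohUnit p q fun h => hpq (congrArg (· + 1) h)

end IsUnital

end Contraction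

/-! ### Full subcategories and strict functors -/

namespace AInfData

open CSeq

variable {k : Type u} [CommRing k] {C : AInfData.{u, v, w} k} (s : Set C.Obj)

variable (C) in
/-- A sequence of morphisms in a full subcategory, as a sequence in the ambient category. -/
def fullMap {X Y : (C.full s).Obj} (p : CSeq (C.full s).Tot X Y) : CSeq C.Tot X.1 Y.1 :=
  p.map Subtype.val (fun f => f)

lemma full_m_pair {X Y Z : (C.full s).Obj} (g : (C.full s).Tot Y Z) (f : (C.full s).Tot X Y) :
    (C.full s).m (pair g f) = C.m (pair (X := X.1) (Y := Y.1) (Z := Z.1) g f) := rfl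

lemma fullMap_append {X Y Z : (C.full s).Obj} (p : CSeq (C.full s).Tot X Y)
    (q : CSeq (C.full s).Tot Y Z) :
    C.fullMap s (p.append q) = (C.fullMap s p).append (C.fullMap s q) :=
  CSeq.map_append _ _ p q

lemma length_fullMap {X Y : (C.full s).Obj} (p : CSeq (C.full s).Tot X Y) :
    (C.fullMap s p).length = p.length :=
  CSeq.length_map _ _ p

lemma HomogSeq.fullMap {X Y : (C.full s).Obj} {p : CSeq (C.full s).Tot X Y} {n : ℤ}
    (h : (C.full s).HomogSeq p n) : C.HomogSeq (C.fullMap s p) n := by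
  induction h with
  | nil X => exact .nil X.1
  | cons hf _ ih => exact .cons hf ih

lemma ins_fullMap {A : Type*} [AddCommMonoid A] {X Y : (C.full s).Obj}
    (φ : CSeq C.Tot X.1 Y.1 → A) (p : CSeq (C.full s).Tot X Y) :
    ins C.m (fun {X Y} f => -signMap k (C.Hom X Y) f) φ (C.fullMap s p) =
      ins (C.full s).m (fun {X Y} f => -signMap k ((C.full s).Hom X Y) f)
        (fun q => φ (C.fullMap s q)) p :=
  ins_map (T := (C.full s).Tot) (T' := C.Tot) (C.full s).m _ Subtype.val (fun f => f) C.m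
    (fun {X Y} f => -signMap k (C.Hom X Y) f) (fun _ => rfl) (fun _ => rfl) φ p

theorem IsAInfCategory.full (h : C.IsAInfCategory) : (C.full s).IsAInfCategory := by
  have m_append_cons : ∀ {W X Y Z : (C.full s).Obj} (p : CSeq (C.full s).Tot W X)
      (f : (C.full s).Tot X Y) (q : CSeq (C.full s).Tot Y Z), (C.full s).m (p.append (cons f q)) =
        C.m ((C.fullMap s p).append (cons (Obj := C.Obj) (T := C.Tot) f (C.fullMap s q))) :=
    fun p f q => congrArg C.m (fullMap_append s p _)
  refine ⟨fun X => h.m_nil X.1, ⟨fun p f g q => ?_, fun p a f q => ?_⟩, fun p n hp => ?_,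
    fun {X Y} p => ?_, fun f => h.m_two_unit f, fun g => h.unit_m_two g, fun p q hpq => ?_⟩
  · exact (m_append_cons p (f + g) q).trans ((h.multilinear.map_add _ f g _).trans
      (congrArg₂ (· + ·) (m_append_cons p f q) (m_append_cons p g q)).symm)
  · exact (m_append_cons p (a • f) q).trans ((h.multilinear.map_smul _ a f _).trans
      (congrArg (a • ·) (m_append_cons p f q)).symm)
  · have h_degree := h.degree _ n hp.fullMap
    rw [length_fullMap] at h_degree
    exact h_degree
  · exact (ins_fullMap s (fun q => C.m q) p).symm.trans (h.relation (C.fullMap s p))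
  · refine (m_append_cons p _ q).trans (h.m_unit _ _ ?_)
    rwa [length_fullMap, length_fullMap]

lemma fullIncl_of_two_le {X Y : (C.full s).Obj} (p : CSeq (C.full s).Tot X Y)
    (hp : 2 ≤ p.length) : C.fullIncl s p = 0 := by
  rcases p with _ | ⟨f, _ | ⟨g, p⟩⟩
  · rfl
  · simp [length] at hp
  · rfl

lemma sum_map_blocks_succ {C D : AInfData.{u, v, w} k} (F : C.Obj → D.Obj)
    (G : ∀ {X Y : C.Obj}, CSeq C.Tot X Y → D.Tot (F X) (F Y)) {A : Type*} [AddCommMonoid A] (r : ℕ)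
    {X Y Z : C.Obj} (f : C.Tot X Y) (p : CSeq C.Tot Y Z) (φ : CSeq D.Tot (F X) (F Z) → A) :
    ((blocks F G (r + 1) (cons f p)).map φ).sum = cutSum (fun _ a b =>
      ((blocks F G r b).map (fun q => φ (cons (G (cons f a)) q))).sum) p := by
  have sum_flatMap : ∀ {α : Type (max v w)} (l : List α) (F : α → List A),
      (l.flatMap F).sum = (l.map fun x => (F x).sum).sum := by
    intro α l F
    induction l with
    | nil => simp
    | cons a l ih => simp [ih]
  rw [blocks, List.map_flatMap, sum_flatMap, properCuts, List.map_map]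
  simp only [List.map_map]
  rfl

/-- Only the partition into single morphisms contributes. -/
lemma sum_map_blocks_fullIncl {A : Type*} [AddCommMonoid A] (r : ℕ) :
    ∀ {X Y : (C.full s).Obj} (p : CSeq (C.full s).Tot X Y) (φ : CSeq C.Tot X.1 Y.1 → A),
    (∀ {W Z : C.Obj} (a : CSeq C.Tot X.1 W) (b : CSeq C.Tot Z Y.1),
      φ (a.append (cons 0 b)) = 0) →
    ((blocks (C := C.full s) (D := C) Subtype.val (C.fullIncl s) r p).map φ).sum =
      if r = p.length then φ (C.fullMap s p) else 0 := by
  induction r with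
  | zero =>
    intro X Y p φ _
    cases p with
    | nil X => simp [blocks, length, fullMap, CSeq.map]
    | cons f p => simp [blocks, length]
  | succ r ih =>
    intro X Y p φ hφ
    cases p with
    | nil X => simp [blocks, properCuts, length]
    | cons f p =>
      refine (sum_map_blocks_succ _ _ r f p φ).trans ((cutSum_eq_nil_left _ p ?_).trans ?_)
      · intro Z a b _ ha
        rw [fullIncl_of_two_le s (cons f a) (by simpa [length] using ha)]
        refine List.sum_eq_zero fun x hx => ?_
        obtain ⟨y, -, rfl⟩ := List.mem_map.1 hx
        exact hφ (nil _) y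
      · rw [ih p _ fun a b => hφ (cons (C.fullIncl s (cons f (nil _))) a) b]
        simp only [length, Nat.add_right_cancel_iff]
        rfl

section IsMultilinear

variable {U : C.Obj → C.Obj → Type w'} [∀ X Y, AddCommGroup (U X Y)] [∀ X Y, Module k (U X Y)]
  {φ : ∀ {X Y : C.Obj}, CSeq C.Tot X Y → U X Y}

lemma IsMultilinear.map_zero (h : C.IsMultilinear (U := U) φ) {W X Y Z : C.Obj}
    (p : CSeq C.Tot W X) (q : CSeq C.Tot Y Z) :
    φ (p.append (cons (0 : C.Tot X Y) q)) = 0 := by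
  have h_smul := h.map_smul p (0 : k) (0 : C.Tot X Y) q
  rwa [zero_smul, zero_smul] at h_smul

lemma IsMultilinear.isLinearMap_single (h : C.IsMultilinear (U := U) φ) (X Y : C.Obj) :
    IsLinearMap k (fun f : C.Tot X Y => φ (single f)) where
  map_add f g := h.map_add (nil X) f g (nil Y)
  map_smul a f := h.map_smul (nil X) a f (nil Y)

end IsMultilinear

lemma isMultilinear_fullIncl :
    (C.full s).IsMultilinear (U := fun X Y => C.Tot X.1 Y.1) (C.fullIncl s) := by
  constructor
  · intro W X Y Z p f g q
    rcases p with _ | ⟨f', _ | ⟨f'', p⟩⟩ <;> rcases q with _ | ⟨g', q⟩ <;>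
      first | exact (add_zero _).symm | rfl
  · intro W X Y Z p a f q
    rcases p with _ | ⟨f', _ | ⟨f'', p⟩⟩ <;> rcases q with _ | ⟨g', q⟩ <;>
      first | exact (smul_zero _).symm | rfl

lemma fullIncl_mem_homogeneous {X Y : (C.full s).Obj} {p : CSeq (C.full s).Tot X Y} {n : ℤ}
    (hp : (C.full s).HomogSeq p n) :
    C.fullIncl s p ∈ homogeneous k (C.Hom X.1 Y.1) (n + 1 - p.length) := by
  rcases hp with _ | @⟨_, Y, _, f, _, a, _, hf, _ | _⟩
  · exact zero_mem _
  · have h_degree : a + 0 + 1 - ((single f).length : ℤ) = a := by simp [single, length]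
    exact h_degree.symm ▸ hf
  · exact zero_mem _

theorem IsAInfCategory.isAInfFunctor_fullIncl (h : C.IsAInfCategory) :
    IsAInfFunctor (C.full s) C Subtype.val (C.fullIncl s) := by
  refine ⟨fun X => rfl, isMultilinear_fullIncl s, fun p n hp => fullIncl_mem_homogeneous s hp,
    fun {X Y} p => ?_, fun X => rfl, fun p q hpq => ?_⟩
  · rw [insertSum_eq_ins]
    simp only [sum_map_blocks_fullIncl s _ p (fun q => C.m q)
      (fun a b => h.multilinear.map_zero a b)]
    rw [Finset.sum_ite_eq']
    rcases Nat.eq_zero_or_pos p.length with hp | hp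
    · cases p with
      | nil X => simp [length]
      | cons f p => simp [length] at hp
    · rw [if_pos (Finset.mem_Icc.2 ⟨hp, le_rfl⟩),
        ins_eq_single _ _ _ (fun q hq => fullIncl_of_two_le s q hq) p hp]
      rfl
  · exact fullIncl_of_two_le s _ (by rw [length_append]; simp only [length]; omega)

namespace IsAInfFunctor

variable {C D : AInfData.{u, v, w} k} {U : C.Obj → D.Obj}
  {F G : ∀ {X Y : C.Obj}, CSeq C.Tot X Y → D.Tot (U X) (U Y)}

lemma map_m_pair (hF : IsAInfFunctor C D U F)
    (hF_strict : ∀ {X Y : C.Obj} (p : CSeq C.Tot X Y), 2 ≤ p.length → F p = 0)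
    (hD : ∀ {X Y : D.Obj} (f : D.Tot X Y), D.m (single f) = 0)
    {X Y Z : C.Obj} (g : C.Tot Y Z) (f : C.Tot X Y) :
    F (single (C.m (pair g f))) = D.m (pair (F (single g)) (F (single f))) := by
  have h_rel := hF.relation (pair g f)
  have h_length : (pair g f).length = 2 := rfl
  have h_one_block : D.m (single (F (pair g f))) = 0 := hD _
  rw [insertSum_eq_ins, ins_eq_single _ _ _ (fun q hq => hF_strict q hq) _ (by rw [h_length]; simp),
    h_length, Finset.sum_Icc_succ_top (by norm_num), Finset.Icc_self, Finset.sum_singleton] at h_rel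
  rw [← h_rel]
  simpa [blocks, pair, single, properCuts, cuts] using h_one_block

theorem eq_of_isGeneratedBy (hF : IsAInfFunctor C D U F) (hG : IsAInfFunctor C D U G)
    (hF_strict : ∀ {X Y : C.Obj} (p : CSeq C.Tot X Y), 2 ≤ p.length → F p = 0)
    (hG_strict : ∀ {X Y : C.Obj} (p : CSeq C.Tot X Y), 2 ≤ p.length → G p = 0)
    (hD : ∀ {X Y : D.Obj} (f : D.Tot X Y), D.m (single f) = 0)
    {S : Set (Σ X Y : C.Obj, C.Tot X Y)} (hS : C.IsGeneratedBy S)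
    (hFG : ∀ f ∈ S, F (single f.2.2) = G (single f.2.2)) {X Y : C.Obj} (p : CSeq C.Tot X Y) :
    F p = G p := by
  let E (X Y : C.Obj) : Submodule k (C.Tot X Y) :=
    LinearMap.eqLocus ((hF.multilinear.isLinearMap_single X Y).mk' _)
      ((hG.multilinear.isLinearMap_single X Y).mk' _)
  have hE : ∀ X Y, E X Y = ⊤ := by
    refine hS E (fun X => (hF.map_unit X).trans (hG.map_unit X).symm) hFG ?_
    intro X Y Z g f (hg : F (single g) = G (single g)) (hf : F (single f) = G (single f))
    change F (single _) = G (single _)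
    rw [hF.map_m_pair hF_strict hD, hG.map_m_pair hG_strict hD, hg, hf]
  rcases p with _ | ⟨f, _ | ⟨g, p⟩⟩
  · rw [hF.nil, hG.nil]
  · have hf : f ∈ E _ _ := hE _ _ ▸ Submodule.mem_top
    exact hf
  · have h_length : 2 ≤ (cons f (cons g p)).length := by simp only [length]; omega
    rw [hF_strict _ h_length, hG_strict _ h_length]

end IsAInfFunctor

end AInfData

/-! ### Contractions over a field -/

section Existence

open CochainComplex.HomComplex

/-- Linear choices that split the complex of morphisms from `K` to `L`: representatives `i` of the
cohomology classes, retractions `r` onto the cocycles, and preimages `g` of the coboundaries.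
Only the values `g n m` with `m + 1 = n` matter. -/
structure HomSplitting (k : Type u) [CommRing k] {𝒞 : Type v} [Category.{w} 𝒞] [Preadditive 𝒞]
    [Linear k 𝒞] (K L : CochainComplex 𝒞 ℤ) where
  i : ∀ n : ℤ, HomCohomology k K L n →ₗ[k] cocycles k K L n
  r : ∀ n : ℤ, Cochain K L n →ₗ[k] cocycles k K L n
  g : ∀ n m : ℤ, Cochain K L n →ₗ[k] Cochain K L m
  mk_i : ∀ (n : ℤ) (x : HomCohomology k K L n), Submodule.Quotient.mk (i n x) = x
  r_coe : ∀ (n : ℤ) (z : cocycles k K L n), r n z = z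
  δ_g_δ : ∀ (n m : ℤ) (x : Cochain K L m), δ m n (g n m (δ m n x)) = δ m n x

namespace HomSplitting

section CommRing

variable {k : Type u} [CommRing k] {𝒞 : Type v} [Category.{w} 𝒞] [Preadditive 𝒞] [Linear k 𝒞]
  {K L : CochainComplex 𝒞 ℤ} (σ : HomSplitting k K L) {l n m : ℤ}

/-- The class of the retraction onto the cocycles, the map `p` of the contraction. -/
def p (n : ℤ) : Cochain K L n →ₗ[k] HomCohomology k K L n := Submodule.mkQ _ ∘ₗ σ.r n

/-- The homotopy of the contraction. A cochain is projected to the coboundaries, and the preimage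
chosen by `g` is corrected by a cocycle in order to lie in the complement `ker r` of the
cocycles. -/
def H (n m : ℤ) : Cochain K L n →ₗ[k] Cochain K L m :=
  (LinearMap.id - (cocycles k K L m).subtype ∘ₗ σ.r m) ∘ₗ σ.g n m ∘ₗ
    (cocycles k K L n).subtype ∘ₗ (σ.r n - σ.i n ∘ₗ σ.p n)

lemma p_eq_mk_r (f : Cochain K L n) : σ.p n f = Submodule.Quotient.mk (σ.r n f) := rfl

lemma p_coe (z : cocycles k K L n) : σ.p n z = Submodule.Quotient.mk z := by
  rw [p_eq_mk_r, r_coe]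

lemma p_i (x : HomCohomology k K L n) : σ.p n (σ.i n x) = x := by rw [p_coe, mk_i]

lemma H_apply (f : Cochain K L n) :
    σ.H n m f = σ.g n m (σ.r n f - σ.i n (σ.p n f) : cocycles k K L n) -
      σ.r m (σ.g n m (σ.r n f - σ.i n (σ.p n f) : cocycles k K L n)) := rfl

lemma r_δ (f : Cochain K L n) : (σ.r m (δ n m f) : Cochain K L m) = δ n m f :=
  congrArg Subtype.val (σ.r_coe m ⟨δ n m f, δ_δ n m (m + 1) f⟩)

lemma p_δ (h : n + 1 = m) (f : Cochain K L n) : σ.p m (δ n m f) = 0 := by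
  obtain rfl : n = m - 1 := by omega
  rw [p_eq_mk_r, Submodule.Quotient.mk_eq_zero]
  exact ⟨f, (σ.r_δ f).symm⟩

lemma δ_coe_cocycle (h : n + 1 = m) (z : cocycles k K L n) : δ n m z.1 = 0 := by
  subst h
  exact z.2

lemma r_H (f : Cochain K L n) : σ.r m (σ.H n m f) = 0 := by
  rw [H_apply, map_sub, r_coe, sub_self]

lemma H_H (f : Cochain K L m) : σ.H n l (σ.H m n f) = 0 := by
  rw [H_apply, p_eq_mk_r, r_H]
  simp

lemma H_i (x : HomCohomology k K L n) : σ.H n l (σ.i n x) = 0 := by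
  rw [H_apply, r_coe, p_i]
  simp

lemma exists_δ_eq_r_sub_i_p (f : Cochain K L n) :
    ∃ y : Cochain K L (n - 1),
      δ (n - 1) n y = (σ.r n f - σ.i n (σ.p n f) : cocycles k K L n) := by
  have h_class :
      (Submodule.Quotient.mk (σ.r n f - σ.i n (σ.p n f)) : HomCohomology k K L n) = 0 := by
    rw [Submodule.Quotient.mk_sub, mk_i, p_eq_mk_r, sub_self]
  exact (Submodule.Quotient.mk_eq_zero _).1 h_class

lemma δ_H (h : l + 1 = n) (f : Cochain K L n) :
    δ l n (σ.H n l f) = (σ.r n f - σ.i n (σ.p n f) : cocycles k K L n) := by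
  obtain rfl : l = n - 1 := by omega
  obtain ⟨y, hy⟩ := σ.exists_δ_eq_r_sub_i_p f
  rw [H_apply, δ_sub, δ_coe_cocycle h, sub_zero, ← hy, δ_g_δ]

lemma H_δ (h : n + 1 = m) (f : Cochain K L n) : σ.H m n (δ n m f) = f - σ.r n f := by
  have h_cocycle : δ n (n + 1) (σ.g m n (δ n m f) - f) = 0 := by
    rw [h, δ_sub, δ_g_δ, sub_self]
  have h_r := congrArg Subtype.val (σ.r_coe n ⟨_, h_cocycle⟩)
  rw [map_sub, Submodule.coe_sub] at h_r
  rw [H_apply, σ.p_δ h, map_zero, sub_zero, r_δ, sub_eq_sub_iff_sub_eq_sub]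
  exact h_r.symm

end CommRing

section Field

variable {k : Type u} [Field k] {𝒞 : Type v} [Category.{w} 𝒞] [Preadditive 𝒞] [Linear k 𝒞]

lemma exists_generalizedInverse {V W : Type*} [AddCommGroup V] [Module k V] [AddCommGroup W]
    [Module k W] (f : V →ₗ[k] W) : ∃ g : W →ₗ[k] V, ∀ x, f (g (f x)) = f x := by
  obtain ⟨s, hs⟩ := f.rangeRestrict.exists_rightInverse_of_surjective f.range_rangeRestrict
  obtain ⟨g, hg⟩ := s.exists_extend
  refine ⟨g, fun x => ?_⟩
  calc f (g (f x)) = f (s (f.rangeRestrict x)) :=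
        congrArg f (LinearMap.congr_fun hg (f.rangeRestrict x))
    _ = f x := congrArg Subtype.val (LinearMap.congr_fun hs (f.rangeRestrict x))

protected lemma nonempty (K L : CochainComplex 𝒞 ℤ) : Nonempty (HomSplitting k K L) := by
  have h_i (n : ℤ) := (Submodule.mkQ ((LinearMap.range (δ_hom k K L (n - 1) n)).submoduleOf
    (cocycles k K L n))).exists_rightInverse_of_surjective (Submodule.range_mkQ _)
  have h_r (n : ℤ) := (LinearMap.id : cocycles k K L n →ₗ[k] _).exists_extend
  have h_g (n m : ℤ) := exists_generalizedInverse (δ_hom k K L m n)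
  choose i hi using h_i
  choose r hr using h_r
  choose g hg using h_g
  exact ⟨⟨i, r, g, fun n => LinearMap.congr_fun (hi n), fun n => LinearMap.congr_fun (hr n), hg⟩⟩

end Field

end HomSplitting

theorem Contraction.nonempty {k : Type u} [Field k] {𝒞 : Type v} [Category.{w} 𝒞] [Preadditive 𝒞]
    [Linear k 𝒞] {ι : Type w'} (K : ι → CochainComplex 𝒞 ℤ) : Nonempty (Contraction k K) := by
  have σ (X Y : ι) : HomSplitting k (K X) (K Y) := Classical.choice (HomSplitting.nonempty _ _)
  exact ⟨{
    i := fun X Y => (σ X Y).i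
    p := fun X Y => (σ X Y).p
    H := fun X Y => (σ X Y).H
    class_i := fun X Y => (σ X Y).mk_i
    p_δ := fun X Y _ _ h => (σ X Y).p_δ h
    p_i := fun X Y _ => (σ X Y).p_i
    homotopy := fun X Y l n m hl hm f => by
      rw [(σ X Y).δ_H hl, (σ X Y).H_δ hm, Submodule.coe_sub]
      abel
    H_H := fun X Y _ _ _ _ _ => (σ X Y).H_H
    H_i := fun X Y _ _ _ => (σ X Y).H_i }⟩

end Existence

/-! ### Morphisms between the resolutions of the simple modules -/

namespace PiA2

variable {k : Type u} [Field k]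

lemma mul_eq_zero_of_e_eq_zero {x y : PiA2 k} (hx : x.e = 0) (hy : y.e = 0) : x * y = 0 := by
  ext l <;> simp [hx, hy]

lemma zmod_two_add_one_add_one (l : ZMod 2) : l + 1 + 1 = l := by revert l; decide

lemma zmod_two_add_one_ne (l : ZMod 2) : l + 1 ≠ l := by revert l; decide

lemma zmod_two_eq_add_one {l m : ZMod 2} (h : l ≠ m) : l = m + 1 := by revert l m; decide

lemma idem_mul_arr (i : ZMod 2) : (idem (i + 1) * arr i : PiA2 k) = arr i := by
  ext l
  · simp [arr]
  · by_cases hl : l = i <;> simp [idem, arr, hl]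

lemma eq_smul_arr {x : PiA2 k} {a b : ZMod 2} (hab : a ≠ b) (ha : idem a * x = x)
    (hb : x * idem b = x) : x = x.a b • arr b := by
  have hxe (l : ZMod 2) : x.e l = 0 := by
    have ha' := congrArg (fun y => e y l) ha
    have hb' := congrArg (fun y => e y l) hb
    simp only [mul_e, idem, Pi.single_apply] at ha' hb'
    split_ifs at ha' hb' with hla hlb
    · exact absurd (hla.symm.trans hlb) hab
    all_goals simp_all
  ext l
  · simp [hxe, arr]
  · have hb' := congrArg (fun y => PiA2.a y l) hb
    by_cases hl : l = b
    · simp [hl, arr]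
    · simpa [idem, arr, Pi.single_apply, hl, eq_comm] using hb'

lemma eq_smul_idem {x : PiA2 k} {a : ZMod 2} (ha : idem a * x = x) (hb : x * idem a = x) :
    x = x.e a • idem a := by
  ext l
  · have hb' := congrArg (fun y => e y l) hb
    by_cases hl : l = a
    · simp [hl, idem]
    · simpa [idem, Pi.single_apply, hl, eq_comm] using hb'
  · have ha' := congrArg (fun y => PiA2.a y l) ha
    have hb' := congrArg (fun y => PiA2.a y l) hb
    by_cases hl : l = a
    · subst hl
      simpa [idem, Pi.single_apply, zmod_two_add_one_ne, eq_comm] using ha'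
    · simpa [idem, Pi.single_apply, hl, eq_comm] using hb'

end PiA2

namespace PObj

open PiA2 CochainComplex.HomComplex

variable {k : Type u} [Field k]

/-- The generator of the term in degree `p` of the resolution of `S_j`; it is zero for `p > 0`,
where the term vanishes. -/
def gen (k : Type u) [Field k] (j : ZMod 2) (p : ℤ) : PiA2 k :=
  if p ≤ 0 then idem (j + p) else 0

lemma gen_mem (j : ZMod 2) (p : ℤ) : gen k j p ∈ term k (S j) p := by
  simp only [gen, term]
  split_ifs with h
  · rw [mem_proj, idem_mul_idem]
  · exact zero_mem _

lemma mul_gen {j : ZMod 2} {p : ℤ} {x : PiA2 k} (hx : x ∈ term k (S j) p) : x * gen k j p = x := by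
  simp only [gen]
  simp only [term] at hx
  split_ifs at hx ⊢ with h
  · exact (mem_proj _ _).1 hx
  · rw [(Submodule.mem_bot _).1 hx, zero_mul]

lemma gen_mul_dElt (j : ZMod 2) {p q : ℤ} (h : p + 1 = q) :
    gen k j p * dElt k (S j) p q = dElt k (S j) p q := by
  by_cases hq : q ≤ 0
  · have hpq : j + (p : ZMod 2) = j + (q : ZMod 2) + 1 := by
      subst h
      push_cast
      rw [← add_assoc, zmod_two_add_one_add_one]
    rw [gen, dElt, if_pos (by lia), if_pos ⟨h, hq⟩, hpq, idem_mul_arr]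
  · rw [dElt, if_neg (by lia), mul_zero]

lemma dElt_e (j : ZMod 2) (p q : ℤ) : (dElt k (S j) p q).e = 0 := by
  simp only [dElt]
  split_ifs <;> rfl

variable {j i l : ZMod 2} {n m : ℤ}

/-- The component of a cochain from degree `p` to degree `q`, as a map between submodules of the
algebra. -/
def app (f : Cochain (cpx k (S j)) (cpx k (S i)) n) (p q : ℤ) (h : p + n = q) :
    term k (S j) p →ₗ[PiA2 k] term k (S i) q := (f.v p q h).hom

/-- The component of a cochain from degree `p` to degree `q` is right multiplication by an element
of the algebra, its value on the generator; a cochain is thus a matrix over the algebra. -/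
def entry (f : Cochain (cpx k (S j)) (cpx k (S i)) n) (p q : ℤ) (h : p + n = q) : PiA2 k :=
  app f p q h ⟨gen k j p, gen_mem j p⟩

lemma app_apply (f : Cochain (cpx k (S j)) (cpx k (S i)) n) (p q : ℤ) (h : p + n = q)
    (x : term k (S j) p) : (app f p q h x : PiA2 k) = x * entry f p q h := by
  have hx : x = (x : PiA2 k) • (⟨gen k j p, gen_mem j p⟩ : term k (S j) p) :=
    Subtype.ext (mul_gen x.2).symm
  conv_lhs => rw [hx, map_smul]
  rfl

lemma entry_mul_gen (f : Cochain (cpx k (S j)) (cpx k (S i)) n) (p q : ℤ) (h : p + n = q) :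
    entry f p q h * gen k i q = entry f p q h := mul_gen (app f p q h _).2

lemma gen_mul_entry (f : Cochain (cpx k (S j)) (cpx k (S i)) n) (p q : ℤ) (h : p + n = q) :
    gen k j p * entry f p q h = entry f p q h :=
  (app_apply f p q h ⟨gen k j p, gen_mem j p⟩).symm

lemma entry_eq_zero (f : Cochain (cpx k (S j)) (cpx k (S i)) n) {p q : ℤ} (h : p + n = q)
    (hpq : ¬(p ≤ 0 ∧ q ≤ 0)) : entry f p q h = 0 := by
  by_cases hp : p ≤ 0
  · rw [← entry_mul_gen, gen, if_neg (fun hq => hpq ⟨hp, hq⟩), mul_zero]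
  · rw [← gen_mul_entry, gen, if_neg hp, zero_mul]

lemma cochain_ext {f g : Cochain (cpx k (S j)) (cpx k (S i)) n}
    (h : ∀ p q hpq, p ≤ 0 → q ≤ 0 → entry f p q hpq = entry g p q hpq) : f = g := by
  ext p q hpq : 1
  refine ModuleCat.hom_ext (LinearMap.ext fun x => Subtype.ext ?_)
  have h_entry : entry f p q hpq = entry g p q hpq := by
    by_cases h0 : p ≤ 0 ∧ q ≤ 0
    · exact h p q hpq h0.1 h0.2
    · rw [entry_eq_zero f hpq h0, entry_eq_zero g hpq h0]
  exact (app_apply f p q hpq x).trans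
    ((congrArg (x.1 * ·) h_entry).trans (app_apply g p q hpq x).symm)

lemma entry_zero (p q : ℤ) (h : p + n = q) :
    entry (0 : Cochain (cpx k (S j)) (cpx k (S i)) n) p q h = 0 := rfl

lemma entry_smul (a : k) (f : Cochain (cpx k (S j)) (cpx k (S i)) n) (p q : ℤ) (h : p + n = q) :
    entry (a • f) p q h = a • entry f p q h := by
  rw [Algebra.smul_def]
  rfl

lemma entry_id (p q : ℤ) (h : p + 0 = q) :
    entry (Cochain.ofHom (𝟙 (cpx k (S i)))) p q h = gen k i p := by
  obtain rfl : p = q := by lia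
  unfold entry app
  rw [Cochain.ofHom_v]
  rfl

lemma entry_comp {s : ℤ} (f : Cochain (cpx k (S j)) (cpx k (S i)) n)
    (g : Cochain (cpx k (S i)) (cpx k (S l)) m) (h : n + m = s) {p q r : ℤ} (hpq : p + n = q)
    (hqr : q + m = r) (hpr : p + s = r) :
    entry (f.comp g h) p r hpr = entry f p q hpq * entry g q r hqr := by
  refine Eq.trans ?_ (app_apply g q r hqr (app f p q hpq ⟨gen k j p, gen_mem j p⟩))
  unfold entry app
  rw [Cochain.comp_v f g h p q r hpq hqr]
  rfl

lemma entry_δ (hnm : n + 1 = m) (f : Cochain (cpx k (S j)) (cpx k (S i)) n) {p q p' q' : ℤ}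
    (hpq : p + m = q) (hpq' : p + n = q') (hpp' : p + 1 = p') :
    entry (δ n m f) p q hpq = entry f p q' hpq' * dElt k (S i) q' q +
      (-1 : k) ^ m • (dElt k (S j) p p' * entry f p' q (by lia)) := by
  have hf := app_apply f p' q (by lia)
    ⟨gen k j p * dElt k (S j) p p', mul_dElt_mem (S j) p p' (gen k j p)⟩
  change _ = gen k j p * dElt k (S j) p p' * _ at hf
  rw [← gen_mul_dElt j hpp', ← hf, ← Int.cast_negOnePow, Int.cast_smul_eq_zsmul]
  unfold entry app
  rw [δ_v n m hnm f p q hpq q' p' (by lia) hpp']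
  rcases Int.units_eq_one_or m.negOnePow with h | h <;> rw [h]
  · rw [one_smul, Units.val_one, one_smul]
    rfl
  · rw [Units.neg_smul, one_smul, Units.val_neg, Units.val_one, neg_smul, one_smul]
    rfl

lemma add_cast_eq_of_eq (hn : j = i + n) {p q : ℤ} (h : p + n = q) :
    j + (p : ZMod 2) = i + (q : ZMod 2) := by
  rw [hn, ← h]
  push_cast
  ring

lemma entry_eq_smul_arr (hn : j ≠ i + n) (f : Cochain (cpx k (S j)) (cpx k (S i)) n) (p q : ℤ)
    (h : p + n = q) : entry f p q h = (entry f p q h).a (i + q) • arr (i + q) := by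
  by_cases h0 : p ≤ 0 ∧ q ≤ 0
  · have h_left := gen_mul_entry f p q h
    have h_right := entry_mul_gen f p q h
    rw [gen, if_pos h0.1] at h_left
    rw [gen, if_pos h0.2] at h_right
    refine eq_smul_arr (fun hjp => hn (add_right_cancel (b := (p : ZMod 2)) ?_)) h_left h_right
    rw [hjp, ← h]
    push_cast
    ring
  · simp [entry_eq_zero f h h0]

lemma entry_eq_smul_idem (hn : j = i + n) (f : Cochain (cpx k (S j)) (cpx k (S i)) n) (p q : ℤ)
    (h : p + n = q) : entry f p q h = (entry f p q h).e (i + q) • idem (i + q) := by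
  by_cases h0 : p ≤ 0 ∧ q ≤ 0
  · have h_left := gen_mul_entry f p q h
    have h_right := entry_mul_gen f p q h
    rw [gen, if_pos h0.1, add_cast_eq_of_eq hn h] at h_left
    rw [gen, if_pos h0.2] at h_right
    exact eq_smul_idem h_left h_right
  · simp [entry_eq_zero f h h0]

/-- In degrees `n ≡ j - i` a cochain from the resolution of `S_j` to that of `S_i` is given by a
sequence `c` of scalars, indexed here by the degree of the target: its components are `c q` times
identity maps. -/
def diag (k : Type u) [Field k] (j i : ZMod 2) (n : ℤ) (c : ℤ → k) :
    Cochain (cpx k (S j)) (cpx k (S i)) n :=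
  Cochain.mk fun _ q _ => rightMul _ _ (c q • gen k i q) fun x _ => by
    rw [mul_smul_comm, ← smul_mul_assoc]
    exact Submodule.smul_mem _ (c q • x) (gen_mem i q)

lemma entry_diag (hn : j = i + n) (c : ℤ → k) {p q : ℤ} (h : p + n = q) (hp : p ≤ 0) (hq : q ≤ 0) :
    entry (diag k j i n c) p q h = c q • idem (i + q) := by
  change gen k j p * c q • gen k i q = _
  rw [gen, gen, if_pos hp, if_pos hq, add_cast_eq_of_eq hn h, mul_smul_comm, idem_mul_idem]

lemma exists_eq_diag (hn : j = i + n) (f : Cochain (cpx k (S j)) (cpx k (S i)) n) :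
    ∃ c, (∀ q, n < q → c q = 0) ∧ f = diag k j i n c := by
  refine ⟨fun q => (entry f (q - n) q (by lia)).e (i + q), fun q hq => ?_,
    cochain_ext fun p q h hp hq => ?_⟩
  · simp [entry_eq_zero f (show q - n + n = q by lia) (by lia)]
  · obtain rfl : p = q - n := by lia
    rw [entry_diag hn _ h hp hq, ← entry_eq_smul_idem hn f _ q h]

lemma entry_δ_diag (hn : j = i + n) {c : ℤ → k} (hc : ∀ q ≤ 0, n < q → c q = 0) (hnm : n + 1 = m)
    {p q : ℤ} (h : p + m = q) (hp : p ≤ 0) (hq : q ≤ 0) :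
    entry (δ n m (diag k j i n c)) p q h = (c (q - 1) - (-1) ^ n * c q) • arr (i + q) := by
  have h_out : entry (diag k j i n c) p (q - 1) (by lia) * dElt k (S i) (q - 1) q =
      c (q - 1) • arr (i + q) := by
    have hq_pred : i + ((q - 1 : ℤ) : ZMod 2) = i + q + 1 := by
      push_cast
      linear_combination -zmod_two_add_one_add_one i
    rw [entry_diag hn c _ hp (by lia), dElt, if_pos ⟨by lia, hq⟩, smul_mul_assoc, hq_pred,
      idem_mul_arr]
  have h_in : dElt k (S j) p (p + 1) * entry (diag k j i n c) (p + 1) q (by lia) =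
      c q • arr (i + q) := by
    by_cases hp' : p + 1 ≤ 0
    · rw [entry_diag hn c _ hp' hq, dElt, if_pos ⟨rfl, hp'⟩,
        add_cast_eq_of_eq hn (show p + 1 + n = q by lia), mul_smul_comm, arr_mul_idem]
    · rw [entry_eq_zero _ _ (by lia), hc q hq (by lia), mul_zero, zero_smul]
  rw [entry_δ hnm _ h (show p + n = q - 1 by lia) rfl, h_out, h_in, smul_smul, ← add_smul, ← hnm,
    zpow_add_one₀ (neg_ne_zero.2 one_ne_zero)]
  congr 1
  ring

lemma δ_diag_eq_zero_iff (hn : j = i + n) {c : ℤ → k} (hc : ∀ q ≤ 0, n < q → c q = 0) :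
    δ n (n + 1) (diag k j i n c) = 0 ↔ ∀ q ≤ 0, q ≤ n + 1 → c (q - 1) = (-1) ^ n * c q := by
  refine ⟨fun h q hq hqn => ?_, fun h => cochain_ext fun p q hpq hp hq => ?_⟩
  · have h_entry := entry_δ_diag hn hc rfl (show q - (n + 1) + (n + 1) = q by lia) (by lia) hq
    rw [h, entry_zero] at h_entry
    have h_coeff := congrArg (fun x => PiA2.a x (i + q)) h_entry
    simpa [arr, sub_eq_zero] using h_coeff.symm
  · rw [entry_δ_diag hn hc rfl hpq hp hq, h q hq (by lia), sub_self, zero_smul, entry_zero]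

/-- There are no coboundaries in the degrees `n ≡ j - i`: the differential multiplies the
components by arrows, and in degree `n - 1` the components are already multiples of arrows. -/
lemma δ_eq_zero (hn : j = i + m) (hnm : n + 1 = m) (f : Cochain (cpx k (S j)) (cpx k (S i)) n) :
    δ n m f = 0 := by
  have hn' : j ≠ i + n := by
    rw [hn, ← hnm]
    push_cast
    rw [← add_assoc]
    exact zmod_two_add_one_ne _
  have he (p q : ℤ) (h) : (entry f p q h).e = 0 := by
    rw [entry_eq_smul_arr hn' f p q h]
    ext
    simp [arr]
  refine cochain_ext fun p q h _ _ => ?_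
  rw [entry_δ hnm f h rfl rfl, mul_eq_zero_of_e_eq_zero (he _ _ _) (dElt_e ..),
    mul_eq_zero_of_e_eq_zero (dElt_e ..) (he _ _ _), smul_zero, add_zero, entry_zero]

lemma exists_descending_rec (N : ℤ) (a : ℤ → k) (s : k) :
    ∃ c : ℤ → k, (∀ q, N < q → c q = 0) ∧ ∀ q ≤ N, c q = a q + s * c (q + 1) := by
  let b : ℕ → k := Nat.rec 0 fun t x => a (N - t) + s * x
  refine ⟨fun q => b (N + 1 - q).toNat, fun q hq => ?_, fun q hq => ?_⟩
  · have hq' : (N + 1 - q).toNat = 0 := by lia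
    simp only [hq']
    rfl
  · obtain ⟨t, rfl⟩ : ∃ t : ℕ, q = N - t := ⟨(N - q).toNat, by lia⟩
    have ht : (N + 1 - (N - t)).toNat = t + 1 := by lia
    have ht' : (N + 1 - (N - t + 1)).toNat = t := by lia
    simp only [ht, ht', b]

lemma exists_δ_eq (hn : j ≠ i + m) (hnm : n + 1 = m) (z : Cochain (cpx k (S j)) (cpx k (S i)) m) :
    ∃ f : Cochain (cpx k (S j)) (cpx k (S i)) n, δ n m f = z := by
  have hn' : j = i + n := by
    rw [zmod_two_eq_add_one hn, ← hnm]
    push_cast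
    linear_combination zmod_two_add_one_add_one i
  obtain ⟨c, hc, hc_rec⟩ := exists_descending_rec n
    (fun q => (entry z (q - n) (q + 1) (by lia)).a (i + (q + 1 : ℤ))) ((-1) ^ n)
  refine ⟨diag k j i n c, cochain_ext fun p q h hp hq => ?_⟩
  obtain ⟨q, rfl⟩ : ∃ q', q = q' + 1 := ⟨q - 1, by lia⟩
  obtain rfl : p = q - n := by lia
  rw [entry_δ_diag hn' (fun q _ => hc q) hnm h hp hq, add_sub_cancel_right, hc_rec q (by lia),
    add_sub_cancel_right, ← entry_eq_smul_arr hn z _ _ h]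

/-- The cocycle of degree `n` that identifies the truncation in degrees `≤ -n` of the periodic
resolution of `S_j` with that of `S_i`, for `n ≡ j - i`; the signs `(-1) ^ (n * q)` make it
commute with the differentials. -/
def shift (k : Type u) [Field k] (j i : ZMod 2) (n : ℤ) : Cochain (cpx k (S j)) (cpx k (S i)) n :=
  diag k j i n fun q => (-1) ^ (n * q)

lemma entry_shift (hn : j = i + n) {p q : ℤ} (h : p + n = q) (hp : p ≤ 0) (hq : q ≤ 0) :
    entry (shift k j i n) p q h = (-1 : k) ^ (n * q) • idem (i + q) := entry_diag hn _ h hp hq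

lemma neg_one_zpow_mul_sub_one (n q : ℤ) :
    (-1 : k) ^ (n * (q - 1)) = (-1) ^ n * (-1) ^ (n * q) := by
  have h_inv : ((-1 : k) ^ n)⁻¹ = (-1) ^ n := by rw [← inv_zpow, inv_neg_one]
  rw [mul_sub, mul_one, zpow_sub₀ (neg_ne_zero.2 one_ne_zero), div_eq_mul_inv, h_inv, mul_comm]

lemma δ_shift (hn : j = i + n) (hn0 : 0 ≤ n) : δ n (n + 1) (shift k j i n) = 0 := by
  exact (δ_diag_eq_zero_iff hn fun q _ _ => by lia).2 fun q _ _ => neg_one_zpow_mul_sub_one n q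

lemma shift_zero : shift k i i 0 = Cochain.ofHom (𝟙 (cpx k (S i))) := by
  refine cochain_ext fun p q h hp hq => ?_
  obtain rfl : p = q := by lia
  rw [entry_shift (by simp) h hp hq, entry_id, gen, if_pos hp, zero_mul, zpow_zero, one_smul]

lemma shift_one : shift k j i 1 = extCochain k j i := by
  refine cochain_ext fun p q h _ hq => ?_
  change gen k j p * (-1 : k) ^ (1 * q) • gen k i q = gen k j p * extElt k i q
  rw [extElt, gen.eq_def k i, if_pos hq, if_pos hq, one_mul, ← Int.cast_smul_eq_zsmul k,
    Int.cast_negOnePow]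

lemma shift_comp_shift (hn : j = i + n) (hm : i = l + m) (hm0 : 0 ≤ m) {s : ℤ} (h : n + m = s) :
    (shift k j i n).comp (shift k i l m) h = (-1 : k) ^ (n * m) • shift k j l s := by
  have hs : j = l + s := by
    rw [hn, hm, ← h]
    push_cast
    ring
  have h_sq : (-1 : k) ^ (n * m) * (-1) ^ (n * m) = 1 := by
    rw [← mul_zpow, neg_mul_neg, one_mul, one_zpow]
  refine cochain_ext fun p r hpr hp hr => ?_
  have hqr : p + n + m = r := by lia
  rw [entry_comp _ _ h rfl hqr hpr, entry_shift hn rfl hp (by lia), entry_shift hm hqr (by lia) hr,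
    entry_smul, entry_shift hs hpr hp hr, add_cast_eq_of_eq hm hqr, smul_mul_smul_comm,
    idem_mul_idem, smul_smul]
  congr 1
  have h_exp : n * (p + n) + m * r + n * m = s * r := by rw [← hqr, ← h]; ring
  rw [← h_exp, zpow_add₀ (neg_ne_zero.2 one_ne_zero), zpow_add₀ (neg_ne_zero.2 one_ne_zero),
    mul_left_comm, mul_assoc, h_sq, mul_one]

lemma eq_zpow_mul_of_descending_rec {c : ℤ → k} {n N : ℤ}
    (hc : ∀ q ≤ N, c (q - 1) = (-1) ^ n * c q) {q : ℤ} (hq : q ≤ N) :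
    c q = (-1) ^ (n * (q - N)) * c N := by
  induction q, hq using Int.leInductionDown with
  | base => simp
  | pred q hq ih => rw [hc q hq, ih, sub_right_comm, neg_one_zpow_mul_sub_one, mul_assoc]

lemma exists_eq_smul_shift (hn : j = i + n) (hn0 : 0 ≤ n)
    (z : Cochain (cpx k (S j)) (cpx k (S i)) n) (hz : δ n (n + 1) z = 0) :
    ∃ a : k, z = a • shift k j i n := by
  obtain ⟨c, hc, rfl⟩ := exists_eq_diag hn z
  have hc_rec := (δ_diag_eq_zero_iff hn fun q _ => hc q).1 hz
  refine ⟨c 0, cochain_ext fun p q h hp hq => ?_⟩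
  rw [entry_smul, entry_diag hn c h hp hq, entry_shift hn h hp hq, smul_smul,
    eq_zpow_mul_of_descending_rec (fun q hq => hc_rec q hq (by lia)) hq, sub_zero, mul_comm]

lemma eq_zero_of_δ_eq_zero (hn : j = i + n) (hn0 : n < 0)
    (z : Cochain (cpx k (S j)) (cpx k (S i)) n) (hz : δ n (n + 1) z = 0) : z = 0 := by
  obtain ⟨c, hc, rfl⟩ := exists_eq_diag hn z
  have hc_rec := (δ_diag_eq_zero_iff hn fun q _ => hc q).1 hz
  refine cochain_ext fun p q h hp hq => ?_
  rw [entry_diag hn c h hp hq, entry_zero,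
    eq_zpow_mul_of_descending_rec (N := n + 1) (fun q hq => hc_rec q (by lia) hq) (by lia),
    hc _ (by lia), mul_zero, zero_smul]

end PObj

/-! ### Formality and generation -/

namespace Contraction

open CSeq CochainComplex.HomComplex

variable {k : Type u} [CommRing k] {𝒞 : Type v} [Category.{w} 𝒞] [Preadditive 𝒞] [Linear k 𝒞]

lemma δ_comp_eq_zero {K L M : CochainComplex 𝒞 ℤ} {a b s : ℤ} {z : Cochain K L a}
    {w : Cochain L M b} (hz : δ a (a + 1) z = 0) (hw : δ b (b + 1) w = 0) (h : a + b = s) :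
    δ s (s + 1) (z.comp w h) = 0 := by
  rw [δ_comp z w h (a + 1) (b + 1) (s + 1) rfl rfl rfl, hz, hw, Cochain.comp_zero,
    Cochain.zero_comp, smul_zero, add_zero]

lemma cohClass_smul {K L : CochainComplex 𝒞 ℤ} {n : ℤ} {z : Cochain K L n} (a : k)
    (hz : δ n (n + 1) z = 0) (haz : δ n (n + 1) (a • z) = 0) :
    cohClass k (a • z) haz = a • cohClass k z hz :=
  rfl

variable {ι : Type w'} {K : ι → CochainComplex 𝒞 ℤ} (c : Contraction k K) {X Y Z : ι} {n : ℤ}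

lemma cocycle_sub_i_p (z : Cochain (K X) (K Y) n) (hz : δ n (n + 1) z = 0) :
    z - c.i X Y n (c.p X Y n z) = δ (n - 1) n (c.H X Y n (n - 1) z) := by
  rw [c.homotopy X Y (n - 1) n (n + 1) (sub_add_cancel n 1) rfl, hz, map_zero, add_zero]

lemma p_cocycle (z : Cochain (K X) (K Y) n) (hz : δ n (n + 1) z = 0) :
    c.p X Y n z = cohClass k z hz := by
  rw [← c.class_i X Y n (c.p X Y n z), eq_comm, cohClass, Submodule.Quotient.eq]
  exact ⟨c.H X Y n (n - 1) z, (c.cocycle_sub_i_p z hz).symm⟩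

lemma i_cohClass (h : ∀ y : Cochain (K X) (K Y) (n - 1), δ (n - 1) n y = 0)
    (z : Cochain (K X) (K Y) n) (hz : δ n (n + 1) z = 0) :
    (c.i X Y n (cohClass k z hz) : Cochain (K X) (K Y) n) = z := by
  have h_sub := c.cocycle_sub_i_p z hz
  rw [h, c.p_cocycle z hz, sub_eq_zero] at h_sub
  exact h_sub.symm

lemma p_i_comp_i {a b s : ℤ} {z : Cochain (K X) (K Y) a} {w : Cochain (K Y) (K Z) b}
    (hz : δ a (a + 1) z = 0) (hw : δ b (b + 1) w = 0) (h : a + b = s) :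
    c.p X Z s ((c.i X Y a (cohClass k z hz)).1.comp (c.i Y Z b (cohClass k w hw)).1 h) =
      cohClass k (z.comp w h) (δ_comp_eq_zero hz hw h) := by
  have hz_i := c.cocycle_sub_i_p z hz
  have hw_i := c.cocycle_sub_i_p w hw
  rw [c.p_cocycle z hz] at hz_i
  rw [c.p_cocycle w hw] at hw_i
  set z' := (c.i X Y a (cohClass k z hz)).1
  set w' := (c.i Y Z b (cohClass k w hw)).1
  have hz' : δ a (a + 1) z' = 0 := (c.i X Y a (cohClass k z hz)).2
  have h_left : c.p X Z s ((z - z').comp w h) = 0 := by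
    have h_δ := δ_comp (c.H X Y a (a - 1) z) w (show a - 1 + b = s - 1 by lia) a (b + 1) s
      (by lia) (by lia) rfl
    rw [hw, Cochain.comp_zero, zero_add, ← hz_i] at h_δ
    have h_p := c.p_δ X Z (s - 1) s (by lia) ((c.H X Y a (a - 1) z).comp w (by lia))
    rw [h_δ, Units.smul_def, map_zsmul, ← Units.smul_def,
      smul_eq_zero_iff_eq] at h_p
    exact h_p
  have h_right : c.p X Z s (z'.comp (w - w') h) = 0 := by
    have h_δ := δ_comp z' (c.H Y Z b (b - 1) w) (show a + (b - 1) = s - 1 by lia) (a + 1) b s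
      (by lia) rfl (by lia)
    rw [hz', Cochain.zero_comp, smul_zero, add_zero, ← hw_i] at h_δ
    rw [← h_δ, c.p_δ X Z (s - 1) s (by lia)]
  rw [Cochain.sub_comp, map_sub, sub_eq_zero] at h_left
  rw [Cochain.comp_sub, map_sub, sub_eq_zero] at h_right
  rw [← h_right, ← h_left, c.p_cocycle]

lemma rootSum_pair_cohClass {a b s : ℤ} {z : Cochain (K X) (K Y) a} {w : Cochain (K Y) (K Z) b}
    (hz : δ a (a + 1) z = 0) (hw : δ b (b + 1) w = 0) (h : a + b = s) :
    c.rootSum (pair (lof k ℤ (HomCohomology k (K Y) (K Z)) b (cohClass k w hw))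
        (lof k ℤ (HomCohomology k (K X) (K Y)) a (cohClass k z hz))) =
      (a.negOnePow : ℤ) • lof k ℤ (HomCohomology k (K X) (K Z)) s
        (cohClass k (z.comp w h) (δ_comp_eq_zero hz hw h)) := by
  rw [rootSum, branchSum_pair, iTot_lof, iTot_lof, signedComp_lof h, map_zsmul, pTot_lof,
    c.p_i_comp_i hz hw h]

lemma transfer_m_single (f : c.transfer.Tot X Y) : c.transfer.m (single f) = 0 :=
  (c.transfer_m _).trans ((congrArg _ (c.branchSum_single f)).trans (map_zero _))

/-- The cocycles chosen by a contraction are closed under composition on the objects in `s`. Then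
they form a dg subcategory without differential, which is why the full subcategory on `s` of the
transferred structure is formal. -/
def IsCompClosedOn (s : Set ι) : Prop :=
  ∀ X ∈ s, ∀ Y ∈ s, ∀ Z ∈ s, ∀ g f, signedComp k (K X) (K Y) (K Z) (c.iTot Y Z g) (c.iTot X Y f) ∈
    LinearMap.range (c.iTot X Z)

namespace IsCompClosedOn

variable {c} {s : Set ι} (hs : c.IsCompClosedOn s) {X Y : s}
include hs

lemma branchSum_mem_of_lt (p : CohSeq k (fun X : s => K X) X Y)
    (ih : ∀ {X Y : s} (q : CohSeq k (fun X : s => K X) X Y), q.length < p.length →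
      c.edgeSum (q.map Subtype.val fun f => f) ∈ LinearMap.range (c.iTot X Y)) :
    c.branchSum (p.map Subtype.val fun f => f) ∈ LinearMap.range (c.iTot X Y) := by
  rw [branchSum, cutSum_map]
  refine cutSum_mem _ _ p fun Z a b hab => ?_
  subst hab
  cases a with
  | nil => simp [CSeq.map]
  | cons f a =>
    cases b with
    | nil => simp [CSeq.map]
    | cons g b =>
      obtain ⟨x, hx⟩ := ih (cons f a) (by simp [length_append, length])
      obtain ⟨y, hy⟩ := ih (cons g b) (by simp [length_append, length])
      rw [← hx, ← hy]
      exact hs _ X.2 _ Z.2 _ Y.2 y x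

lemma edgeSum_mem (p : CohSeq k (fun X : s => K X) X Y) :
    c.edgeSum (p.map Subtype.val fun f => f) ∈ LinearMap.range (c.iTot X Y) := by
  induction hn : p.length using Nat.strong_induction_on generalizing X Y with
  | _ n ih =>
    obtain ⟨x, hx⟩ := hs.branchSum_mem_of_lt p fun q hq => ih _ (hn ▸ hq) q rfl
    rw [edgeSum_eq, ← hx, hTot_iTot, add_zero]
    rcases p with _ | ⟨f, _ | ⟨g, p⟩⟩
    · exact zero_mem _
    · exact ⟨f, rfl⟩
    · exact zero_mem _

lemma edgeSum_eq_zero (p : CohSeq k (fun X : s => K X) X Y) (hp : 2 ≤ p.length) :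
    c.edgeSum (p.map Subtype.val fun f => f) = 0 := by
  obtain ⟨x, hx⟩ := hs.branchSum_mem_of_lt p fun q _ => hs.edgeSum_mem q
  rw [edgeSum_eq, ← hx, hTot_iTot, add_zero, c.leafSum_of_two_le _ (by rwa [length_map])]

lemma rootSum_eq_zero (p : CohSeq k (fun X : s => K X) X Y) (hp : 2 < p.length) :
    c.rootSum (p.map Subtype.val fun f => f) = 0 := by
  rw [rootSum, branchSum, cutSum_map, cutSum_eq_zero, map_zero]
  intro Z a b hab
  rw [← hab, length_append] at hp
  rcases le_or_gt 2 a.length with ha | ha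
  · rw [hs.edgeSum_eq_zero a ha, map_zero]
  · rw [hs.edgeSum_eq_zero b (by omega), map_zero, LinearMap.zero_apply]

theorem full_transfer_m_eq_zero {X Y : (c.transfer.full s).Obj}
    (p : CSeq (c.transfer.full s).Tot X Y) (hp : 2 < p.length) : (c.transfer.full s).m p = 0 :=
  (c.transfer_m _).trans (hs.rootSum_eq_zero p hp)

end IsCompClosedOn

end Contraction

section Simples

open CSeq CochainComplex.HomComplex PiA2 PObj

variable {k : Type u} [Field k] {j i l : ZMod 2} {n : ℤ}

lemma homCohomology_eq_zero_of_ne (hn : j ≠ i + n)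
    (x : HomCohomology k (cpx k (S j)) (cpx k (S i)) n) : x = 0 := by
  obtain ⟨z, rfl⟩ := Submodule.Quotient.mk_surjective _ x
  obtain ⟨y, hy⟩ := exists_δ_eq hn (sub_add_cancel n 1) z.1
  exact (Submodule.Quotient.mk_eq_zero _).2 ⟨y, hy⟩

lemma homCohomology_eq_zero_of_neg (hn0 : n < 0)
    (x : HomCohomology k (cpx k (S j)) (cpx k (S i)) n) : x = 0 := by
  by_cases hn : j = i + n
  · obtain ⟨z, rfl⟩ := Submodule.Quotient.mk_surjective _ x
    rw [show z = 0 from Subtype.ext (eq_zero_of_δ_eq_zero hn hn0 z.1 z.2)]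
    rfl
  · exact homCohomology_eq_zero_of_ne hn x

lemma exists_eq_smul_cohClass_shift (hn : j = i + n) (hn0 : 0 ≤ n)
    (x : HomCohomology k (cpx k (S j)) (cpx k (S i)) n) :
    ∃ a : k, x = a • cohClass k (shift k j i n) (δ_shift hn hn0) := by
  obtain ⟨z, rfl⟩ := Submodule.Quotient.mk_surjective _ x
  obtain ⟨a, ha⟩ := exists_eq_smul_shift hn hn0 z.1 z.2
  refine ⟨a, ?_⟩
  rw [cohClass, ← Submodule.Quotient.mk_smul]
  exact congrArg _ (Subtype.ext ha)

variable (c : Contraction k (cpx k))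

lemma isUnital_cpx : c.IsUnital := by
  intro X
  refine c.i_cohClass (fun y => ?_) _ _
  cases X with
  | S i => exact δ_eq_zero (by simp) (sub_add_cancel 0 1) y
  | P i =>
    have hd (p q : ℤ) : (cpx k (P i)).d p q = 0 :=
      ModuleCat.hom_ext (LinearMap.ext fun x => Subtype.ext (mul_zero x.1))
    refine Cochain.ext _ _ fun p q h => ?_
    rw [δ_v (0 - 1) 0 (sub_add_cancel 0 1) y p q h (q - 1) (p + 1) rfl rfl, hd, hd,
      Limits.comp_zero, Limits.zero_comp, smul_zero, add_zero, Cochain.zero_v]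

lemma isCompClosedOn_simples : c.IsCompClosedOn {X | ∃ i, X = S i} := by
  rintro _ ⟨j, rfl⟩ _ ⟨i, rfl⟩ _ ⟨l, rfl⟩ g f
  induction g using DirectSum.induction_on with
  | zero => simp
  | add g g' h h' => simp only [map_add, LinearMap.add_apply]; exact add_mem h h'
  | of b y =>
  induction f using DirectSum.induction_on with
  | zero => simp
  | add f f' h h' => simp only [map_add]; exact add_mem h h'
  | of a x =>
  simp only [← lof_eq_of k]
  by_cases hx : j = i + a
  swap
  · rw [homCohomology_eq_zero_of_ne hx x]
    simp
  by_cases hy : i = l + b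
  swap
  · rw [homCohomology_eq_zero_of_ne hy y]
    simp
  have hjl : j = l + ((a + b : ℤ) : ZMod 2) := by
    rw [hx, hy]
    push_cast
    ring
  have h_cocycle := Contraction.δ_comp_eq_zero (c.i (S j) (S i) a x).2 (c.i (S i) (S l) b y).2 rfl
  rw [Contraction.iTot_lof, Contraction.iTot_lof, signedComp_lof rfl,
    ← c.i_cohClass (fun y => δ_eq_zero hjl (sub_add_cancel _ 1) y) _ h_cocycle,
    ← Contraction.iTot_lof]
  exact zsmul_mem (LinearMap.mem_range_self _ _) _

section Generation

variable {c} {W : ∀ j i : ZMod 2, Submodule k (⨁ n, HomCohomology k (cpx k (S j)) (cpx k (S i)) n)}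
  (h_unit : ∀ j, Contraction.cohUnit k (cpx k) (S j) ∈ W j j)
  (h_ext : ∀ j, lof k ℤ (HomCohomology k (cpx k (S j)) (cpx k (S (j + 1)))) 1
    (extClass k j (j + 1)) ∈ W j (j + 1))
  (h_mul : ∀ {j i l} g f, g ∈ W i l → f ∈ W j i → c.rootSum (pair g f) ∈ W j l)
include h_unit h_ext h_mul

lemma cohClass_shift_mem (hn : j = i + n) (hn0 : 0 ≤ n) :
    lof k ℤ (HomCohomology k (cpx k (S j)) (cpx k (S i))) n
      (cohClass k (shift k j i n) (δ_shift hn hn0)) ∈ W j i := by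
  induction n, hn0 using Int.leInduction generalizing j with
  | base =>
    obtain rfl : j = i := by simpa using hn
    simp only [shift_zero]
    exact h_unit j
  | succ n hn0 ih =>
    have h_one : j = j + 1 + ((1 : ℤ) : ZMod 2) := by
      rw [Int.cast_one, zmod_two_add_one_add_one]
    have hn' : j + 1 = i + (n : ZMod 2) := by
      rw [hn, Int.cast_add, Int.cast_one, ← add_assoc, zmod_two_add_one_add_one]
    have h_prod := h_mul _ _ (ih hn') (h_ext j)
    rw [extClass, c.rootSum_pair_cohClass _ _ (add_comm 1 n)] at h_prod
    simp only [← shift_one, shift_comp_shift h_one hn' hn0] at h_prod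
    rw [Contraction.cohClass_smul _ (δ_shift hn (by lia)), map_smul, ← Int.cast_smul_eq_zsmul k,
      smul_smul] at h_prod
    exact ((W j i).smul_mem_iff (by simp [zpow_ne_zero])).1 h_prod

theorem eq_top_of_extClass_mem (j i : ZMod 2) : W j i = ⊤ := by
  refine eq_top_iff.2 fun f _ => ?_
  induction f using DirectSum.induction_on with
  | zero => exact zero_mem _
  | add f g hf hg => exact add_mem (hf trivial) (hg trivial)
  | of n x =>
    rw [← lof_eq_of k]
    by_cases hn : j = i + n
    · rcases lt_or_ge n 0 with hn0 | hn0
      · rw [homCohomology_eq_zero_of_neg hn0 x, map_zero]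
        exact zero_mem _
      · obtain ⟨a, rfl⟩ := exists_eq_smul_cohClass_shift hn hn0 x
        rw [map_smul]
        exact Submodule.smul_mem _ a (cohClass_shift_mem h_unit h_ext h_mul hn hn0)
    · rw [homCohomology_eq_zero_of_ne hn x, map_zero]
      exact zero_mem _

end Generation

lemma simples_m_pair (g : (simples c).Tot (simple c i) (simple c l))
    (f : (simples c).Tot (simple c j) (simple c i)) :
    (simples c).m (pair g f) = c.rootSum (pair (X := S j) (Y := S i) (Z := S l) g f) :=
  (AInfData.full_m_pair _ g f).trans (c.transfer_m (pair (X := S j) (Y := S i) (Z := S l) g f))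

lemma isGeneratedBy_alpha_beta :
    (simples c).IsGeneratedBy {⟨_, _, alpha c⟩, ⟨_, _, beta c⟩} := by
  intro W h_unit h_gen h_mul
  have h_alpha (j i : ZMod 2) (hj : j = 2) (hi : i = 1) :
      lof k ℤ (HomCohomology k (cpx k (S j)) (cpx k (S i))) 1 (extClass k j i) ∈
        W (simple c j) (simple c i) := by
    subst hj hi
    exact h_gen ⟨_, _, alpha c⟩ (Or.inl rfl)
  have h_beta (j i : ZMod 2) (hj : j = 1) (hi : i = 2) :
      lof k ℤ (HomCohomology k (cpx k (S j)) (cpx k (S i))) 1 (extClass k j i) ∈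
        W (simple c j) (simple c i) := by
    subst hj hi
    exact h_gen ⟨_, _, beta c⟩ (Or.inr rfl)
  have h_cases : ∀ j : ZMod 2, (j = 2 ∧ j + 1 = 1) ∨ (j = 1 ∧ j + 1 = 2) := by decide
  rintro ⟨_, j, rfl⟩ ⟨_, i, rfl⟩
  refine eq_top_of_extClass_mem (c := c) (W := fun j i => W (simple c j) (simple c i))
    (fun j => h_unit (simple c j)) (fun j => ?_) (fun {j i l} g f hg hf => ?_) j i
  · exact (h_cases j).elim (fun h => h_alpha _ _ h.1 h.2) fun h => h_beta _ _ h.1 h.2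
  · have h_pair := h_mul (X := simple c j) (Y := simple c i) (Z := simple c l) g f hg hf
    rwa [simples_m_pair c g f] at h_pair

end Simples

end

theorem mainTheorem4 (k : Type u) [Field k] :
    Nonempty (Contraction k (PObj.cpx k)) ∧
    ∀ c : Contraction k (PObj.cpx k),
      (preproj c).IsAInfCategory ∧ (simples c).IsAInfCategory ∧
      -- the subcategory of simples is generated by `α` and `β`
      (simples c).IsGeneratedBy {⟨_, _, alpha c⟩, ⟨_, _, beta c⟩} ∧
      -- formality
      (∀ (X Y : (simples c).Obj) (f : (simples c).Tot X Y),
        (simples c).m (CSeq.single f) = 0) ∧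
      (∀ (X Y : (simples c).Obj) (p : CSeq (simples c).Tot X Y),
        2 < p.length → (simples c).m p = 0) ∧
      -- the inclusion is a strict functor
      AInfData.IsAInfFunctor (simples c) (preproj c) Subtype.val (incl c) ∧
      (∀ (X Y : (simples c).Obj) (f : (simples c).Tot X Y), incl c (CSeq.single f) = f) ∧
      (∀ (X Y : (simples c).Obj) (p : CSeq (simples c).Tot X Y),
        2 ≤ p.length → incl c p = 0) ∧
      -- it is determined by its values on `α` and `β` and the vanishing of its higher components
      (∀ G : ∀ {X Y : (simples c).Obj},
          CSeq (simples c).Tot X Y → (preproj c).Tot X.1 Y.1,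
        AInfData.IsAInfFunctor (simples c) (preproj c) Subtype.val G →
        G (CSeq.single (alpha c)) = alpha c → G (CSeq.single (beta c)) = beta c →
        (∀ (X Y : (simples c).Obj) (p : CSeq (simples c).Tot X Y), 2 ≤ p.length → G p = 0) →
        ∀ (X Y : (simples c).Obj) (p : CSeq (simples c).Tot X Y), G p = incl c p) := by
  refine ⟨Contraction.nonempty _, fun c => ?_⟩
  have h_preproj : (preproj c).IsAInfCategory := (isUnital_cpx c).isAInfCategory
  have h_incl := h_preproj.isAInfFunctor_fullIncl {X : PObj | ∃ i, X = PObj.S i}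
  have h_gen := isGeneratedBy_alpha_beta c
  refine ⟨h_preproj, h_preproj.full _, h_gen, fun _ _ f => c.transfer_m_single f,
    fun _ _ p hp => (isCompClosedOn_simples c).full_transfer_m_eq_zero p hp,
    h_incl, fun _ _ _ => rfl, fun _ _ p hp => AInfData.fullIncl_of_two_le _ p hp, ?_⟩
  intro G hG hGα hGβ hG_strict X Y p
  refine hG.eq_of_isGeneratedBy h_incl (fun p hp => hG_strict _ _ p hp)
    (fun p hp => AInfData.fullIncl_of_two_le _ p hp) (fun f => c.transfer_m_single f) h_gen ?_ p
  rintro f (rfl | rfl)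
  · exact hGα
  · exact hGβ
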